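/- **Setting.** Let $n,K,p\ge 1$ and let $(y_i,\boldsymbol x_i)$, $i=1,\dots,n$, be i.i.d. with $y_i\in\mathbb R$ and $\boldsymbol x_i=(1,x_{i1},\dots,x_{ip})^\top\in\mathbb R^{p+1}$. Let $0<\tau_1<\dots<\tau_K<1$ and suppose that $y_i=\boldsymbol x_i^\top\boldsymbol\beta_k^*+\epsilon_i^k$ with $P(\epsilon_i^k<0\mid \boldsymbol x_i)=\tau_k$ for each $k$. For $\boldsymbol\beta=(\boldsymbol\beta_1,\dots,\boldsymbol\beta_K)\in\mathbb R^{K(p+1)}$ write $\boldsymbol\beta^j=(\beta_{1j},\dots,\beta_{Kj})\in\mathbb R^K$. With $\rho_\tau(u)=u(\tau-\mathbf 1\{u<0\})$, let $\hat{\boldsymbol\beta}$ be a minimizer over $\mathbb R^{K(p+1)}$ of $$\frac1n\sum_{k=1}^K\sum_{i=1}^n\rho_{\tau_k}(y_i-\boldsymbol x_i^\top\boldsymbol\beta_k)+\lambda\sum_{j=1}^p\|\boldsymbol\beta^j\|_2 .$$ Let $\mathcal S=\{j\in\{1,\dots,p\}:\boldsymbol\beta^{*j}\ne 0\}$, $s=|\mathcal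 S|$, $\bar{\mathcal S}=\mathcal S\cup\{0\}$, let $$\mathcal C=\Big\{\boldsymbol\Delta\in\mathbb R^{K(p+1)}:\ \sum_{j\notin\bar{\mathcal S}}\|\boldsymbol\Delta^j\|_2\le 3\sum_{j\in\bar{\mathcal S}}\|\boldsymbol\Delta^j\|_2\Big\},$$ and let $\mathcal C_k=\{\boldsymbol\Delta_k:\boldsymbol\Delta\in\mathcal C\}\subseteq\mathbb R^{p+1}$. **Conditions.** 1. There are $c_1,c_2>0$ such that, almost surely, the conditional law of $y_i$ given $\boldsymbol x_i$ has a differentiable density $f_i$ with $f_i(\boldsymbol x_i^\top\boldsymbol\beta^*_k)\ge c_1$ for all $k$ and $|f_i'(t)|\le c_2$ for all $t\in\mathbb R$. 2. There is $C_x>0$ such that almost surely $|x_{ij}|<C_x$ for all $i\in\{1,\dots,n\}$, $j\in\{0,\dots,p\}$. 3. There are positive constants $b_k,B_k$ $(k=1,\dots,K)$ and $\tilde b,\tilde B$ with $\tilde b\le b_k$, $B_k\le\tilde B$ and $b_k\|\boldsymbol v\|_2^2\le \boldsymbol v^\top E[\boldsymbol x_i\boldsymbol x_i^\top]\boldsymbol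 v\le B_k\|\boldsymbol v\|_2^2$ for all $k$ and all $\boldsymbol v\in\mathcal C_k$. 4. There is $\tilde d>0$ such that for all $k$ $$\tilde d\le d_k=\frac{c_1}{c_2\sqrt{B_k}}\ \inf_{\boldsymbol\Delta\in\mathcal C,\ \|\boldsymbol\Delta_k\|_2\ne0}\frac{E[(\boldsymbol x_i^\top\boldsymbol\Delta_k)^2]^{3/2}}{E[|\boldsymbol x_i^\top\boldsymbol\Delta_k|^3]}.$$ **Theorem.** There is an absolute constant $A>0$ with the following property. In the setting above assume Conditions 1–4, let $D_1,D_2>0$, and let $$\lambda=C_x\sqrt{\frac Kn}+2C_x\sqrt{\frac{D_2K\log p}{n}},\qquad \delta^*=8C^*\sqrt{\frac{s+1}{n}}\Big[4D_1\sqrt{\log p}+\sqrt{2K}\Big],$$ where $C^*$ is any constant with $C^*\ge A\,C_x\sqrt K$ and, in case $c_2<1$, also $C^*\ge A\,C_x\sqrt{K(1+D_2)}$. If $$\frac{3}{c_1\tilde b}\Big[\max\Big(\delta^*,K\sqrt{\tfrac{8\tilde B}{n}}\Big)+c_2\lambda\sqrt s\Big]<\tilde d,$$ then, with probability at least $1-16p^{1-D_1}-2p^{1-D_2}$,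 every minimizer $\hat{\boldsymbol\beta}$ satisfies $$\|\hat{\boldsymbol\beta}-\boldsymbol\beta^*\|_2\le\frac{3}{c_1\tilde b}\Big[\max\Big(\delta^*,K\sqrt{\tfrac{8\tilde B}{n}}\Big)+c_2\lambda\sqrt s\Big].$$ -/

import Mathlib

open MeasureTheory ProbabilityTheory Matrix

noncomputable section

namespace GQLasso

/-- The Euclidean norm of a finite real vector. -/
def l2norm {ι : Type*} [Fintype ι] (v : ι → ℝ) : ℝ := ‖WithLp.toLp 2 v‖

/-- The quantile (check) loss at level `τ`. -/
def checkLoss (τ u : ℝ) : ℝ := u * (τ - if u < 0 then 1 else 0)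

/-- A coefficient array: `b k j` is the coefficient of predictor `j` at the `k`-th quantile level;
the index `j = 0` is the intercept and `j = 1, …, p` are the predictors. -/
abbrev Coef (K p : ℕ) : Type := Fin K → Fin (p + 1) → ℝ

/-- The Euclidean norm of the group of predictor `j`, across all quantile levels. -/
def groupNorm {K p : ℕ} (b : Coef K p) (j : Fin (p + 1)) : ℝ := l2norm (fun k => b k j)

/-- The Euclidean norm of the whole coefficient array, as a vector of length `K (p + 1)`. -/
def coefNorm {K p : ℕ} (b : Coef K p) : ℝ :=
  l2norm (fun q : Fin K × Fin (p + 1) => b q.1 q.2)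

/-- The group-lasso multi-quantile objective; the intercept group is not penalized. -/
def objective {n K p : ℕ} (τ : Fin K → ℝ) (lam : ℝ) (xs : Fin n → Fin (p + 1) → ℝ)
    (ys : Fin n → ℝ) (b : Coef K p) : ℝ :=
  (1 / (n : ℝ)) * ∑ k : Fin K, ∑ i : Fin n, checkLoss (τ k) (ys i - xs i ⬝ᵥ b k)
    + lam * ∑ j : Fin p, groupNorm b j.succ

/-- `b` is a value of the estimator: a global minimizer of the objective. -/
def IsEstimate {n K p : ℕ} (τ : Fin K → ℝ) (lam : ℝ) (xs : Fin n → Fin (p + 1) → ℝ)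
    (ys : Fin n → ℝ) (b : Coef K p) : Prop :=
  ∀ b' : Coef K p, objective τ lam xs ys b ≤ objective τ lam xs ys b'

open Classical in
/-- The predictors (the intercept excluded) that are active at some quantile level. -/
def activeSet {K p : ℕ} (β : Coef K p) : Finset (Fin (p + 1)) :=
  Finset.univ.filter (fun j => j ≠ 0 ∧ groupNorm β j ≠ 0)

open Classical in
/-- The active predictors together with the intercept. -/
def activeSetBar {K p : ℕ} (β : Coef K p) : Finset (Fin (p + 1)) := insert 0 (activeSet β)

open Classical in
/-- The cone in which the estimation error is compared with the support of `β`. -/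
def cone {K p : ℕ} (β : Coef K p) : Set (Coef K p) :=
  {Δ | ∑ j ∈ (activeSetBar β)ᶜ, groupNorm Δ j ≤ 3 * ∑ j ∈ activeSetBar β, groupNorm Δ j}

/-- The `k`-th blocks of the elements of the cone. -/
def coneBlock {K p : ℕ} (β : Coef K p) (k : Fin K) : Set (Fin (p + 1) → ℝ) :=
  (fun Δ : Coef K p => Δ k) '' cone β

/-- The uncentred second moment matrix of a random vector. -/
def secondMoment {Ω : Type*} [MeasurableSpace Ω] {p : ℕ} (μ : Measure Ω)
    (X : Ω → Fin (p + 1) → ℝ) : Matrix (Fin (p + 1)) (Fin (p + 1)) ℝ :=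
  Matrix.of (fun j l => ∫ ω, X ω j * X ω l ∂μ)

/-- The sample is i.i.d., the first entry of each covariate vector is one, and the conditional
quantile of `y i` given `x i` at level `τ k` is linear with coefficient vector `β k`:
the conditional probability that `y i - x i ⬝ᵥ β k < 0` is `τ k`. -/
structure Model {Ω : Type*} [MeasurableSpace Ω] {n K p : ℕ} (μ : Measure Ω)
    [IsProbabilityMeasure μ] (x : Fin n → Ω → Fin (p + 1) → ℝ) (y : Fin n → Ω → ℝ)
    (τ : Fin K → ℝ) (β : Coef K p) : Prop where
  measurable_x : ∀ i, Measurable (x i)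
  measurable_y : ∀ i, Measurable (y i)
  indep : iIndepFun (fun i ω => (x i ω, y i ω)) μ
  ident : ∀ i i', IdentDistrib (fun ω => (x i ω, y i ω)) (fun ω => (x i' ω, y i' ω)) μ μ
  intercept : ∀ i, ∀ᵐ ω ∂μ, x i ω 0 = 1
  level_mem : ∀ k, τ k ∈ Set.Ioo (0 : ℝ) 1
  level_strictMono : StrictMono τ
  quantile : ∀ i k, ∀ᵐ w ∂(μ.map (x i)),
    condDistrib (y i) (x i) μ w (Set.Iio (w ⬝ᵥ β k)) = ENNReal.ofReal (τ k)

/-- The conditional law of `y i` given `x i` has a differentiable density whose value at each of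
the `K` modelled conditional quantiles is at least `c₁` and whose derivative is bounded by `c₂` on
the whole line. (A probability density cannot be bounded below by `c₁ > 0` on the whole line.) -/
def DensityCondition {Ω : Type*} [MeasurableSpace Ω] {n K p : ℕ} (μ : Measure Ω)
    [IsProbabilityMeasure μ] (x : Fin n → Ω → Fin (p + 1) → ℝ) (y : Fin n → Ω → ℝ)
    (β : Coef K p) (c₁ c₂ : ℝ) : Prop :=
  0 < c₁ ∧ 0 < c₂ ∧ ∀ i, ∀ᵐ w ∂(μ.map (x i)), ∃ f : ℝ → ℝ,
    (∀ t, 0 ≤ f t) ∧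
    condDistrib (y i) (x i) μ w = volume.withDensity (fun t => ENNReal.ofReal (f t)) ∧
    Differentiable ℝ f ∧
    (∀ k, c₁ ≤ f (w ⬝ᵥ β k)) ∧
    ∀ t, |deriv f t| ≤ c₂

/-- The covariates are bounded by `Cx`, almost surely. -/
def BoundedCovariates {Ω : Type*} [MeasurableSpace Ω] {n p : ℕ} (μ : Measure Ω)
    (x : Fin n → Ω → Fin (p + 1) → ℝ) (Cx : ℝ) : Prop :=
  0 < Cx ∧ ∀ᵐ ω ∂μ, ∀ i j, |x i ω j| < Cx

/-- Restricted eigenvalue bounds for the second moment matrix over the blocks of the cone. -/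
def EigenvalueCondition {Ω : Type*} [MeasurableSpace Ω] {n K p : ℕ} (μ : Measure Ω)
    (x : Fin n → Ω → Fin (p + 1) → ℝ) (β : Coef K p) (b B : Fin K → ℝ) (bt Bt : ℝ) : Prop :=
  0 < bt ∧ 0 < Bt ∧ (∀ k, 0 < b k ∧ 0 < B k ∧ bt ≤ b k ∧ B k ≤ Bt) ∧
  ∀ i k, ∀ v ∈ coneBlock β k,
    b k * l2norm v ^ 2 ≤ v ⬝ᵥ (secondMoment μ (x i) *ᵥ v) ∧
    v ⬝ᵥ (secondMoment μ (x i) *ᵥ v) ≤ B k * l2norm v ^ 2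

/-- The restricted nonlinearity constant `d_k` of block `k`. -/
def nonlinearityConst {Ω : Type*} [MeasurableSpace Ω] {K p : ℕ} (μ : Measure Ω)
    (X : Ω → Fin (p + 1) → ℝ) (β : Coef K p) (c₁ c₂ : ℝ) (B : Fin K → ℝ) (k : Fin K) : ℝ :=
  c₁ / (c₂ * √(B k)) *
    sInf ((fun Δ : Coef K p =>
      (∫ ω, (X ω ⬝ᵥ Δ k) ^ 2 ∂μ) ^ (3 / 2 : ℝ) / ∫ ω, |X ω ⬝ᵥ Δ k| ^ 3 ∂μ) ''
        {Δ | Δ ∈ cone β ∧ l2norm (Δ k) ≠ 0})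

/-- The restricted nonlinearity constants are bounded below by `dt > 0`. -/
def NonlinearityCondition {Ω : Type*} [MeasurableSpace Ω] {n K p : ℕ} (μ : Measure Ω)
    (x : Fin n → Ω → Fin (p + 1) → ℝ) (β : Coef K p) (c₁ c₂ : ℝ) (B : Fin K → ℝ)
    (dt : ℝ) : Prop :=
  0 < dt ∧ ∀ i k, dt ≤ nonlinearityConst μ (x i) β c₁ c₂ B k

/-- The tuning parameter `λ`. -/
def tuning (n K p : ℕ) (Cx D₂ : ℝ) : ℝ :=
  Cx * √(K / n) + 2 * Cx * √(D₂ * K * Real.log p / n)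

/-- The quantity `δ*`. -/
def deltaStar (n K p s : ℕ) (Cstar D₁ : ℝ) : ℝ :=
  8 * Cstar * √((s + 1) / n) * (4 * D₁ * √(Real.log p) + √(2 * K))

/-- The upper bound for the estimation error. -/
def errorBound (n K p s : ℕ) (Cstar D₁ c₁ c₂ bt Bt lam : ℝ) : ℝ :=
  3 / (c₁ * bt) * (max (deltaStar n K p s Cstar D₁) (K * √(8 * Bt / n)) + c₂ * lam * √s)

end GQLasso

end

/-!
The proof compares the objective at the estimate with the objective at `β`, on an event where two
random quantities are controlled.

*Score.* The subgradients of the loss at `β` form, for each predictor `j`, a vector in `ℝ^K` whose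
coordinates are sums of independent centred variables with range at most `Cx`; by Hoeffding's lemma
conditionally on the covariates they are sub-Gaussian. The convexity of `exp` turns the squared
Euclidean norm of this vector into an average over coordinates of square-exponential moments
(`measure_sum_sq_ge_le`), which gives the tail `p ^ (-D₂)` at the level `λ / 2` without a union
bound over quantile levels (`measure_groupNorm_scoreSum_gt_le`).

*Empirical process.* For one quantile level, the increments of the loss are `1`-Lipschitz functions
of `x ⬝ᵥ v`. Replacing the summands one after the other by `± 2 x ⬝ᵥ v` (symmetrization and the
Ledoux–Talagrand contraction, both inside an exponential) bounds the exponential moment of the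
supremum over an `ℓ¹` ball by a sum of hyperbolic cosines over the coordinates
(`lintegral_exp_sup'_empirical_le`). The resulting deviation is proportional to the radius of the
ball, so a dyadic peeling of the radii lets the `K` levels share a single `ℓ¹` budget
(`sum_le_three_mul_of_dyadic`).

On the event, if an estimate were at distance more than `R = errorBound` from `β`, convexity would
give an array `β + Δ` with `‖Δ‖ = R` whose objective is at most that of `β`. The score bound puts
`Δ` in the cone (`mem_cone_of_objective_le`). There the expected loss grows by at least
`c₁ bt / 3 * R ^ 2` (`integral_lossDiff_ge_of_mem_cone`: a Taylor bound for the conditional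
distribution function, whose cubic remainder is absorbed since `R < dt`), while the objective
inequality bounds this growth by the deviation of the empirical loss plus `λ √s R`. The two are
incompatible for `A = 10` (`empirical_add_penalty_lt`). The numerical steps use `p ≥ 2` and
`D₁, D₂ ≥ 1`, which hold whenever the claimed probability is positive.
-/

noncomputable section

namespace GQLasso

/-! ### Euclidean norms of vectors and coefficient arrays -/

section Norms

variable {ι : Type*} [Fintype ι]

lemma l2norm_nonneg (v : ι → ℝ) : 0 ≤ l2norm v := norm_nonneg _

lemma l2norm_sq (v : ι → ℝ) : l2norm v ^ 2 = ∑ i, v i ^ 2 := by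
  simp [l2norm, EuclideanSpace.norm_sq_eq]

lemma l2norm_add_le (v w : ι → ℝ) : l2norm (v + w) ≤ l2norm v + l2norm w := by
  simpa [l2norm] using norm_add_le (WithLp.toLp 2 v) (WithLp.toLp 2 w)

lemma l2norm_smul (c : ℝ) (v : ι → ℝ) : l2norm (c • v) = |c| * l2norm v := by
  simp [l2norm, norm_smul]

lemma l2norm_eq_zero {v : ι → ℝ} : l2norm v = 0 ↔ v = 0 := by
  simp [l2norm]

lemma sum_mul_le_l2norm (v w : ι → ℝ) : ∑ i, v i * w i ≤ l2norm v * l2norm w := by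
  refine (abs_le_of_sq_le_sq' ?_ (mul_nonneg (l2norm_nonneg _) (l2norm_nonneg _))).2
  rw [mul_pow, l2norm_sq, l2norm_sq]
  exact Finset.sum_mul_sq_le_sq_mul_sq _ _ _

lemma sum_le_sqrt_card_mul {κ : Type*} (s : Finset κ) (v : κ → ℝ) {r : ℝ} (hr : 0 ≤ r)
    (h : ∑ i ∈ s, v i ^ 2 ≤ r ^ 2) : ∑ i ∈ s, v i ≤ √s.card * r := by
  refine (abs_le_of_sq_le_sq' ?_ (by positivity)).2
  rw [mul_pow, Real.sq_sqrt (by positivity)]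
  exact sq_sum_le_card_mul_sum_sq.trans (by gcongr)

lemma sum_abs_le_sqrt_card_mul_l2norm (v : ι → ℝ) :
    ∑ i, |v i| ≤ √(Fintype.card ι) * l2norm v := by
  have := sum_le_sqrt_card_mul Finset.univ (fun i => |v i|) (l2norm_nonneg v)
    (by simp [l2norm_sq])
  simpa using this

variable {K p : ℕ}

lemma groupNorm_nonneg (Δ : Coef K p) (j : Fin (p + 1)) : 0 ≤ groupNorm Δ j := l2norm_nonneg _

lemma groupNorm_add_le (Δ Δ' : Coef K p) (j : Fin (p + 1)) :
    groupNorm (Δ + Δ') j ≤ groupNorm Δ j + groupNorm Δ' j := l2norm_add_le _ _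

lemma groupNorm_smul (c : ℝ) (Δ : Coef K p) (j : Fin (p + 1)) :
    groupNorm (c • Δ) j = |c| * groupNorm Δ j := l2norm_smul c (fun k => Δ k j)

lemma coefNorm_nonneg (Δ : Coef K p) : 0 ≤ coefNorm Δ := l2norm_nonneg _

lemma coefNorm_smul (c : ℝ) (Δ : Coef K p) : coefNorm (c • Δ) = |c| * coefNorm Δ :=
  l2norm_smul c (fun q : Fin K × Fin (p + 1) => Δ q.1 q.2)

lemma coefNorm_sq_eq_sum_block (Δ : Coef K p) : coefNorm Δ ^ 2 = ∑ k, l2norm (Δ k) ^ 2 := by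
  simp only [coefNorm, l2norm_sq, Fintype.sum_prod_type]

lemma coefNorm_sq_eq_sum_group (Δ : Coef K p) : coefNorm Δ ^ 2 = ∑ j, groupNorm Δ j ^ 2 := by
  simp only [coefNorm, groupNorm, l2norm_sq, Fintype.sum_prod_type]
  exact Finset.sum_comm

lemma l2norm_block_le_coefNorm (Δ : Coef K p) (k : Fin K) : l2norm (Δ k) ≤ coefNorm Δ := by
  refine (abs_le_of_sq_le_sq' ?_ (coefNorm_nonneg Δ)).2
  rw [coefNorm_sq_eq_sum_block]
  exact Finset.single_le_sum (f := fun k => l2norm (Δ k) ^ 2) (fun _ _ => sq_nonneg _)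
    (Finset.mem_univ k)

lemma sum_groupNorm_le (Δ : Coef K p) (s : Finset (Fin (p + 1))) :
    ∑ j ∈ s, groupNorm Δ j ≤ √s.card * coefNorm Δ := by
  refine sum_le_sqrt_card_mul s _ (coefNorm_nonneg Δ) ?_
  rw [coefNorm_sq_eq_sum_group]
  exact Finset.sum_le_univ_sum_of_nonneg fun _ => sq_nonneg _

lemma sum_abs_le_sqrt_mul_sum_groupNorm (Δ : Coef K p) :
    ∑ k, ∑ j, |Δ k j| ≤ √K * ∑ j, groupNorm Δ j := by
  rw [Finset.sum_comm, Finset.mul_sum]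
  refine Finset.sum_le_sum fun j _ => ?_
  simpa [groupNorm] using sum_abs_le_sqrt_card_mul_l2norm (fun k => Δ k j)

end Norms

lemma abs_dotProduct_le {ι : Type*} [Fintype ι] {w v : ι → ℝ} {C : ℝ} (hw : ∀ j, |w j| ≤ C) :
    |w ⬝ᵥ v| ≤ C * ∑ j, |v j| := by
  rw [dotProduct, Finset.mul_sum]
  refine (Finset.abs_sum_le_sum_abs _ _).trans (Finset.sum_le_sum fun j _ => ?_)
  rw [abs_mul]
  exact mul_le_mul_of_nonneg_right (hw j) (abs_nonneg _)

/-! ### The check loss -/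

lemma checkLoss_eq_max (τ u : ℝ) : checkLoss τ u = max (τ * u) ((τ - 1) * u) := by
  unfold checkLoss
  split_ifs with h
  · rw [max_eq_right] <;> nlinarith
  · rw [max_eq_left] <;> nlinarith

lemma measurable_checkLoss (τ : ℝ) : Measurable (checkLoss τ) := by
  have : checkLoss τ = fun u => max (τ * u) ((τ - 1) * u) := funext (checkLoss_eq_max τ)
  rw [this]; fun_prop

lemma convexOn_checkLoss (τ : ℝ) : ConvexOn ℝ Set.univ (checkLoss τ) := by
  have : checkLoss τ = (fun u => τ * u) ⊔ (fun u => (τ - 1) * u) := funext (checkLoss_eq_max τ)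
  rw [this]
  exact ((LinearMap.mulLeft ℝ τ).convexOn convex_univ).sup
    ((LinearMap.mulLeft ℝ (τ - 1)).convexOn convex_univ)

lemma abs_checkLoss_sub_le {τ : ℝ} (hτ : τ ∈ Set.Ioo (0 : ℝ) 1) (u v : ℝ) :
    |checkLoss τ u - checkLoss τ v| ≤ |u - v| := by
  rw [checkLoss_eq_max, checkLoss_eq_max]
  refine (abs_max_sub_max_le_max _ _ _ _).trans (max_le ?_ ?_)
  · rw [← mul_sub, abs_mul, abs_of_pos hτ.1]
    exact mul_le_of_le_one_left (abs_nonneg _) hτ.2.le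
  · rw [← mul_sub, abs_mul]
    refine mul_le_of_le_one_left (abs_nonneg _) (abs_le.2 ⟨?_, ?_⟩) <;> linarith [hτ.1, hτ.2]

/-- The subgradient `τ - 1{z < 0}` of the check loss at `z`. -/
def quantileScore (τ z : ℝ) : ℝ := τ - if z < 0 then 1 else 0

lemma measurable_quantileScore (τ : ℝ) : Measurable (quantileScore τ) :=
  measurable_const.sub (Measurable.ite measurableSet_Iio measurable_const measurable_const)

/-- The Bregman remainder `ρ_τ(z - u) - ρ_τ(z) + u (τ - 1{z < 0})`; it does not depend on `τ`. -/
lemma checkLoss_remainder (τ z u : ℝ) :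
    checkLoss τ (z - u) - checkLoss τ z + u * quantileScore τ z =
      Set.indicator (Set.Ico 0 u) (fun z => u - z) z +
        Set.indicator (Set.Ico u 0) (fun z => z - u) z := by
  simp only [checkLoss, quantileScore, Set.indicator, Set.mem_Ico]
  split_ifs <;> first | (exfalso; grind) | grind

lemma checkLoss_remainder_nonneg (τ z u : ℝ) :
    0 ≤ checkLoss τ (z - u) - checkLoss τ z + u * quantileScore τ z := by
  rw [checkLoss_remainder]
  refine add_nonneg (Set.indicator_nonneg ?_ _) (Set.indicator_nonneg ?_ _) <;>
    intro z hz <;> linarith [hz.1, hz.2]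

/-! ### Conditional expectations at a fixed covariate vector -/

section Conditional

variable {ν : Measure ℝ} [IsProbabilityMeasure ν] {τ a : ℝ}

lemma integrable_quantileScore : Integrable (fun y => quantileScore τ (y - a)) ν := by
  refine Integrable.of_bound (C := |τ| + 1)
    ((measurable_quantileScore τ).comp (measurable_id.sub_const a)).aestronglyMeasurable
    (ae_of_all _ fun y => ?_)
  rw [Real.norm_eq_abs, quantileScore]
  refine (abs_sub _ _).trans (add_le_add le_rfl ?_)
  split_ifs <;> simp

lemma integral_quantileScore_eq_zero (hτ : 0 ≤ τ) (hq : ν (Set.Iio a) = ENNReal.ofReal τ) :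
    ∫ y, quantileScore τ (y - a) ∂ν = 0 := by
  have h1 : (fun y => quantileScore τ (y - a)) =
      fun y => τ - (Set.Iio a).indicator (fun _ => (1 : ℝ)) y := by
    funext y
    simp [quantileScore, Set.indicator, sub_neg]
  rw [h1, integral_sub (integrable_const _)
    ((integrable_const _).indicator measurableSet_Iio), integral_indicator measurableSet_Iio]
  simp [measureReal_def, hq, hτ]

/-- Hoeffding's lemma for the centred Bernoulli variable `τ - 1{y < a}`. -/
lemma integral_exp_mul_quantileScore_le (hτ : τ ∈ Set.Ioo (0 : ℝ) 1)
    (hq : ν (Set.Iio a) = ENNReal.ofReal τ) (t : ℝ) :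
    ∫ y, Real.exp (t * quantileScore τ (y - a)) ∂ν ≤ Real.exp (t ^ 2 / 8) := by
  have h := hasSubgaussianMGF_of_mem_Icc_of_integral_eq_zero (μ := ν) (a := τ - 1) (b := τ)
    (X := fun y => quantileScore τ (y - a)) (integrable_quantileScore (ν := ν)).aemeasurable
    (ae_of_all _ fun y => by
      simp only [quantileScore, Set.mem_Icc]; split_ifs <;> constructor <;> linarith)
    (integral_quantileScore_eq_zero hτ.1.le hq)
  refine (h.mgf_le t).trans (Real.exp_le_exp.2 (le_of_eq ?_))
  simp
  ring

/-- A density with value at least `c₁` at `a` and derivative bounded by `c₂` makes the expected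
Bregman remainder of the check loss at least `∫ (c₁ - c₂ |z|) |u - z| dz` over `z` between `0`
and `u`. -/
lemma integral_checkLoss_sub_ge {f : ℝ → ℝ} {c₁ c₂ : ℝ} (hτ : τ ∈ Set.Ioo (0 : ℝ) 1)
    (hq : ν (Set.Iio a) = ENNReal.ofReal τ) (hf0 : ∀ t, 0 ≤ f t)
    (hν : ν = volume.withDensity (fun t => ENNReal.ofReal (f t))) (hf : Differentiable ℝ f)
    (hc₁ : c₁ ≤ f a) (hc₂ : ∀ t, |deriv f t| ≤ c₂) (u : ℝ) :
    c₁ / 2 * u ^ 2 - c₂ / 6 * |u| ^ 3 ≤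
      ∫ y, (checkLoss τ (y - a - u) - checkLoss τ (y - a)) ∂ν := by
  set R : ℝ → ℝ := fun z => Set.indicator (Set.Ico 0 u) (fun z => u - z) z +
    Set.indicator (Set.Ico u 0) (fun z => z - u) z with hR
  have hfc : Continuous f := hf.continuous
  have hlow : ∀ z, c₁ - c₂ * |z| ≤ f (z + a) := by
    intro z
    have := Convex.norm_image_sub_le_of_norm_deriv_le (f := f) (s := Set.univ) (x := a)
      (y := z + a) (fun t _ => hf t) (fun t _ => hc₂ t) convex_univ trivial trivial
    simp only [Real.norm_eq_abs, add_sub_cancel_right] at this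
    linarith [(abs_le.1 this).1]
  have hRint : ∫ y, (checkLoss τ (y - a - u) - checkLoss τ (y - a)) ∂ν = ∫ y, R (y - a) ∂ν := by
    have h1 : Integrable (fun y => checkLoss τ (y - a - u) - checkLoss τ (y - a)) ν := by
      refine Integrable.of_bound (C := |u|) ?_ (ae_of_all _ fun y => ?_)
      · exact (((measurable_checkLoss τ).comp (by fun_prop)).sub
          ((measurable_checkLoss τ).comp (by fun_prop))).aestronglyMeasurable
      · simpa using abs_checkLoss_sub_le hτ (y - a - u) (y - a)
    have h2 : ∀ y, R (y - a) =
        (checkLoss τ (y - a - u) - checkLoss τ (y - a)) + u * quantileScore τ (y - a) :=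
      fun y => (checkLoss_remainder τ (y - a) u).symm
    simp_rw [h2]
    rw [integral_add h1 (integrable_quantileScore.const_mul u), integral_const_mul,
      integral_quantileScore_eq_zero hτ.1.le hq, mul_zero, add_zero]
  have hden : ∫ y, R (y - a) ∂ν = ∫ z, f (z + a) * R z := by
    rw [hν, integral_withDensity_eq_integral_toReal_smul
      (by fun_prop) (ae_of_all _ fun _ => ENNReal.ofReal_lt_top)]
    simp only [ENNReal.toReal_ofReal (hf0 _), smul_eq_mul]
    rw [← integral_sub_right_eq_self (fun z => f (z + a) * R z) a]
    simp only [sub_add_cancel]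
  rw [hRint, hden]
  rcases le_total 0 u with hu | hu
  · have h1 : (fun z => f (z + a) * R z) =
        (Set.Ico 0 u).indicator (fun z => f (z + a) * (u - z)) := by
      funext z
      simp only [hR, Set.Ico_eq_empty_of_le hu, Set.indicator_empty, add_zero]
      exact (Set.indicator_mul_right _ (fun z => f (z + a)) (fun z => u - z)).symm
    rw [h1, integral_indicator measurableSet_Ico, integral_Ico_eq_integral_Ioc,
      ← intervalIntegral.integral_of_le hu]
    have h2 : ∫ z in (0 : ℝ)..u, (c₁ - c₂ * z) * (u - z) = c₁ / 2 * u ^ 2 - c₂ / 6 * |u| ^ 3 := by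
      rw [intervalIntegral.integral_eq_sub_of_hasDerivAt (f := fun z =>
        c₁ * u * z - (c₁ + c₂ * u) * z ^ 2 / 2 + c₂ * z ^ 3 / 3)]
      · rw [abs_of_nonneg hu]; ring
      · intro z _
        have := ((hasDerivAt_id z).const_mul (c₁ * u)).sub
          (((hasDerivAt_pow 2 z).const_mul (c₁ + c₂ * u)).div_const 2) |>.add
          (((hasDerivAt_pow 3 z).const_mul c₂).div_const 3)
        exact HasDerivAt.congr_deriv this (by norm_num; ring)
      · exact Continuous.intervalIntegrable (by fun_prop) _ _
    rw [← h2]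
    refine intervalIntegral.integral_mono_on hu (Continuous.intervalIntegrable (by fun_prop) _ _)
      (Continuous.intervalIntegrable (by fun_prop) _ _) fun z hz => ?_
    refine mul_le_mul_of_nonneg_right ?_ (by linarith [hz.2])
    simpa [abs_of_nonneg hz.1] using hlow z
  · have h1 : (fun z => f (z + a) * R z) =
        (Set.Ico u 0).indicator (fun z => f (z + a) * (z - u)) := by
      funext z
      simp only [hR, Set.Ico_eq_empty_of_le hu, Set.indicator_empty, zero_add]
      exact (Set.indicator_mul_right _ (fun z => f (z + a)) (fun z => z - u)).symm
    rw [h1, integral_indicator measurableSet_Ico, integral_Ico_eq_integral_Ioc,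
      ← intervalIntegral.integral_of_le hu]
    have h2 : ∫ z in u..(0 : ℝ), (c₁ + c₂ * z) * (z - u) = c₁ / 2 * u ^ 2 - c₂ / 6 * |u| ^ 3 := by
      rw [intervalIntegral.integral_eq_sub_of_hasDerivAt (f := fun z =>
        -(c₁ * u * z) + (c₁ - c₂ * u) * z ^ 2 / 2 + c₂ * z ^ 3 / 3)]
      · rw [abs_of_nonpos hu]; ring
      · intro z _
        have := ((hasDerivAt_id z).const_mul (c₁ * u)).neg.add
          (((hasDerivAt_pow 2 z).const_mul (c₁ - c₂ * u)).div_const 2) |>.add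
          (((hasDerivAt_pow 3 z).const_mul c₂).div_const 3)
        exact HasDerivAt.congr_deriv this (by norm_num; ring)
      · exact Continuous.intervalIntegrable (by fun_prop) _ _
    rw [← h2]
    refine intervalIntegral.integral_mono_on hu (Continuous.intervalIntegrable (by fun_prop) _ _)
      (Continuous.intervalIntegrable (by fun_prop) _ _) fun z hz => ?_
    refine mul_le_mul_of_nonneg_right ?_ (by linarith [hz.1])
    simpa [abs_of_nonpos hz.2] using hlow z

end Conditional

/-! ### Averaging over the covariates -/

section Population

variable {Ω : Type*} [MeasurableSpace Ω] {μ : Measure Ω} [IsProbabilityMeasure μ] {p : ℕ}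
  {X : Ω → Fin (p + 1) → ℝ} {Y : Ω → ℝ} {τ C : ℝ} {β : Fin (p + 1) → ℝ}

lemma integral_prod_eq_integral_condDistrib (hX : Measurable X) (hY : Measurable Y)
    {g : (Fin (p + 1) → ℝ) × ℝ → ℝ} (hg : Measurable g)
    (hgi : Integrable (fun ω => g (X ω, Y ω)) μ) :
    Integrable (fun w => ∫ t, g (w, t) ∂(condDistrib Y X μ w)) (μ.map X) ∧
      ∫ ω, g (X ω, Y ω) ∂μ = ∫ w, ∫ t, g (w, t) ∂(condDistrib Y X μ w) ∂(μ.map X) := by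
  have hmap := compProd_map_condDistrib (μ := μ) (X := X) (Y := Y) (mβ := inferInstance) hY.aemeasurable
  have hi : Integrable g (μ.map X ⊗ₘ condDistrib Y X μ) := by
    rw [hmap, integrable_map_measure hg.aestronglyMeasurable (hX.prodMk hY).aemeasurable]
    exact hgi
  refine ⟨MeasureTheory.Integrable.integral_compProd (κ := Kernel.const Unit (μ.map X))
    (η := Kernel.prodMkLeft Unit (condDistrib Y X μ)) (a := ()) hi, ?_⟩
  rw [← Measure.integral_compProd hi, hmap,
    integral_map (hX.prodMk hY).aemeasurable hg.aestronglyMeasurable]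

lemma measurable_dotProduct_left (v : Fin (p + 1) → ℝ) :
    Measurable fun w : Fin (p + 1) → ℝ => w ⬝ᵥ v := by
  unfold dotProduct; fun_prop

lemma integrable_dotProduct_pow (hX : Measurable X) (hC : ∀ᵐ ω ∂μ, ∀ j, |X ω j| ≤ C)
    (v : Fin (p + 1) → ℝ) (m : ℕ) : Integrable (fun ω => |X ω ⬝ᵥ v| ^ m) μ := by
  refine Integrable.of_bound (C := (C * ∑ j, |v j|) ^ m)
    (((measurable_dotProduct_left v).comp hX).abs.pow_const m).aestronglyMeasurable ?_
  filter_upwards [hC] with ω hω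
  rw [Real.norm_eq_abs, abs_pow, abs_abs]
  exact pow_le_pow_left₀ (abs_nonneg _) (abs_dotProduct_le hω) m

/-- The increment of the check loss when the linear predictor moves from `w ⬝ᵥ β` by `w ⬝ᵥ v`,
as a function of the observation `(w, t)`. -/
def lossDiff (τ : ℝ) (β v : Fin (p + 1) → ℝ) (z : (Fin (p + 1) → ℝ) × ℝ) : ℝ :=
  checkLoss τ (z.2 - z.1 ⬝ᵥ β - z.1 ⬝ᵥ v) - checkLoss τ (z.2 - z.1 ⬝ᵥ β)

lemma measurable_lossDiff (τ : ℝ) (β v : Fin (p + 1) → ℝ) : Measurable (lossDiff τ β v) := by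
  have h := fun v => (measurable_dotProduct_left (p := p) v).comp
    (measurable_fst : Measurable (Prod.fst : (Fin (p + 1) → ℝ) × ℝ → Fin (p + 1) → ℝ))
  exact ((measurable_checkLoss τ).comp ((measurable_snd.sub (h β)).sub (h v))).sub
    ((measurable_checkLoss τ).comp (measurable_snd.sub (h β)))

lemma abs_lossDiff_sub_le (hτ : τ ∈ Set.Ioo (0 : ℝ) 1) (β v v' : Fin (p + 1) → ℝ)
    (z : (Fin (p + 1) → ℝ) × ℝ) :
    |lossDiff τ β v z - lossDiff τ β v' z| ≤ |z.1 ⬝ᵥ v - z.1 ⬝ᵥ v'| := by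
  have := abs_checkLoss_sub_le hτ (z.2 - z.1 ⬝ᵥ β - z.1 ⬝ᵥ v) (z.2 - z.1 ⬝ᵥ β - z.1 ⬝ᵥ v')
  rw [show z.2 - z.1 ⬝ᵥ β - z.1 ⬝ᵥ v - (z.2 - z.1 ⬝ᵥ β - z.1 ⬝ᵥ v') =
    -(z.1 ⬝ᵥ v - z.1 ⬝ᵥ v') by ring, abs_neg] at this
  simpa [lossDiff] using this

@[simp] lemma lossDiff_zero (τ : ℝ) (β : Fin (p + 1) → ℝ) (z : (Fin (p + 1) → ℝ) × ℝ) :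
    lossDiff τ β 0 z = 0 := by simp [lossDiff]

lemma abs_lossDiff_le (hτ : τ ∈ Set.Ioo (0 : ℝ) 1) (β v : Fin (p + 1) → ℝ)
    (z : (Fin (p + 1) → ℝ) × ℝ) : |lossDiff τ β v z| ≤ |z.1 ⬝ᵥ v| := by
  simpa using abs_lossDiff_sub_le hτ β v 0 z

lemma integrable_lossDiff (hX : Measurable X) (hY : Measurable Y) (hτ : τ ∈ Set.Ioo (0 : ℝ) 1)
    (hC : ∀ᵐ ω ∂μ, ∀ j, |X ω j| ≤ C) (v : Fin (p + 1) → ℝ) :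
    Integrable (fun ω => lossDiff τ β v (X ω, Y ω)) μ := by
  refine (by simpa using integrable_dotProduct_pow hX hC v 1 :
    Integrable (fun ω => |X ω ⬝ᵥ v|) μ).mono
    ((measurable_lossDiff τ β v).comp (hX.prodMk hY)).aestronglyMeasurable
    (ae_of_all _ fun ω => ?_)
  simpa using abs_lossDiff_le hτ β v (X ω, Y ω)

/-- The conditional bound of `integral_checkLoss_sub_ge` averaged over the covariates. -/
lemma integral_lossDiff_ge {c₁ c₂ : ℝ} (hX : Measurable X) (hY : Measurable Y)
    (hτ : τ ∈ Set.Ioo (0 : ℝ) 1) (hC : ∀ᵐ ω ∂μ, ∀ j, |X ω j| ≤ C)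
    (hq : ∀ᵐ w ∂(μ.map X), condDistrib Y X μ w (Set.Iio (w ⬝ᵥ β)) = ENNReal.ofReal τ)
    (hd : ∀ᵐ w ∂(μ.map X), ∃ f : ℝ → ℝ, (∀ t, 0 ≤ f t) ∧
      condDistrib Y X μ w = volume.withDensity (fun t => ENNReal.ofReal (f t)) ∧
      Differentiable ℝ f ∧ c₁ ≤ f (w ⬝ᵥ β) ∧ ∀ t, |deriv f t| ≤ c₂)
    (v : Fin (p + 1) → ℝ) :
    c₁ / 2 * ∫ ω, (X ω ⬝ᵥ v) ^ 2 ∂μ - c₂ / 6 * ∫ ω, |X ω ⬝ᵥ v| ^ 3 ∂μ ≤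
      ∫ ω, lossDiff τ β v (X ω, Y ω) ∂μ := by
  obtain ⟨hint, heq⟩ := integral_prod_eq_integral_condDistrib (μ := μ) hX hY
    (measurable_lossDiff τ β v) (integrable_lossDiff hX hY hτ hC v)
  have hi2 : Integrable (fun ω => (X ω ⬝ᵥ v) ^ 2) μ := by
    simpa using integrable_dotProduct_pow hX hC v 2
  have hi3 := integrable_dotProduct_pow hX hC v 3
  have hm2 : Measurable fun w : Fin (p + 1) → ℝ => (w ⬝ᵥ v) ^ 2 :=
    (measurable_dotProduct_left v).pow_const 2
  have hm3 : Measurable fun w : Fin (p + 1) → ℝ => |w ⬝ᵥ v| ^ 3 :=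
    (measurable_dotProduct_left v).abs.pow_const 3
  rw [heq, ← integral_map (φ := X) (f := fun w => (w ⬝ᵥ v) ^ 2) hX.aemeasurable
      hm2.aestronglyMeasurable,
    ← integral_map (φ := X) (f := fun w => |w ⬝ᵥ v| ^ 3) hX.aemeasurable hm3.aestronglyMeasurable,
    ← integral_const_mul, ← integral_const_mul]
  have hi2' := ((integrable_map_measure hm2.aestronglyMeasurable hX.aemeasurable).2 hi2).const_mul
    (c₁ / 2)
  have hi3' := ((integrable_map_measure hm3.aestronglyMeasurable hX.aemeasurable).2 hi3).const_mul
    (c₂ / 6)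
  rw [← integral_sub hi2' hi3']
  refine integral_mono_ae (hi2'.sub hi3') hint ?_
  filter_upwards [hq, hd] with w hqw hdw
  obtain ⟨f, hf0, hν, hf, hc₁, hc₂⟩ := hdw
  exact integral_checkLoss_sub_ge hτ hqw hf0 hν hf hc₁ hc₂ _

/-- The variance proxy `C ^ 2 / 4` is that of a variable with range `C`: given the covariates the
score ranges over an interval of length `|X j|`, so the cruder bound `|score| ≤ C` is not used. -/
lemma hasSubgaussianMGF_score (hX : Measurable X) (hY : Measurable Y)
    (hτ : τ ∈ Set.Ioo (0 : ℝ) 1) (hC : ∀ᵐ ω ∂μ, ∀ j, |X ω j| ≤ C)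
    (hq : ∀ᵐ w ∂(μ.map X), condDistrib Y X μ w (Set.Iio (w ⬝ᵥ β)) = ENNReal.ofReal τ)
    (j : Fin (p + 1)) :
    HasSubgaussianMGF (fun ω => X ω j * quantileScore τ (Y ω - X ω ⬝ᵥ β))
      (Real.toNNReal (C ^ 2 / 4)) μ := by
  have hgm : ∀ t, Measurable fun z : (Fin (p + 1) → ℝ) × ℝ =>
      Real.exp (t * (z.1 j * quantileScore τ (z.2 - z.1 ⬝ᵥ β))) := by
    intro t
    have h1 : Measurable fun z : (Fin (p + 1) → ℝ) × ℝ => quantileScore τ (z.2 - z.1 ⬝ᵥ β) :=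
      (measurable_quantileScore τ).comp
        (measurable_snd.sub ((measurable_dotProduct_left β).comp measurable_fst))
    fun_prop
  have hint : ∀ t, Integrable
      (fun ω => Real.exp (t * (X ω j * quantileScore τ (Y ω - X ω ⬝ᵥ β)))) μ := by
    intro t
    refine Integrable.of_bound (C := Real.exp (|t| * C))
      ((hgm t).comp (hX.prodMk hY)).aestronglyMeasurable ?_
    filter_upwards [hC] with ω hω
    rw [Real.norm_eq_abs, Real.abs_exp, Real.exp_le_exp]
    refine (le_abs_self _).trans ?_
    rw [abs_mul, abs_mul]
    refine mul_le_mul_of_nonneg_left ?_ (abs_nonneg _)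
    refine (mul_le_of_le_one_right (abs_nonneg _) ?_).trans (hω j)
    rw [quantileScore, abs_le]
    split_ifs <;> constructor <;> linarith [hτ.1, hτ.2]
  refine ⟨hint, fun t => ?_⟩
  obtain ⟨hi, heq⟩ := integral_prod_eq_integral_condDistrib (μ := μ) hX hY (hgm t) (hint t)
  rw [mgf, heq]
  have hprob : IsProbabilityMeasure (μ.map X) := Measure.isProbabilityMeasure_map hX.aemeasurable
  have hC' : ∀ᵐ w ∂(μ.map X), |w j| ≤ C := by
    rw [ae_map_iff hX.aemeasurable
      (measurableSet_le (measurable_pi_apply j).abs measurable_const)]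
    filter_upwards [hC] with ω hω using hω j
  calc ∫ w, ∫ y, Real.exp (t * (w j * quantileScore τ (y - w ⬝ᵥ β))) ∂(condDistrib Y X μ w)
          ∂(μ.map X)
      ≤ ∫ _, Real.exp (C ^ 2 / 4 * t ^ 2 / 2) ∂(μ.map X) := by
        refine integral_mono_ae hi (integrable_const _) ?_
        filter_upwards [hq, hC'] with w hqw hCw
        simp only [← mul_assoc]
        refine (integral_exp_mul_quantileScore_le hτ hqw (t * w j)).trans (Real.exp_le_exp.2 ?_)
        have : w j ^ 2 ≤ C ^ 2 := sq_le_sq' (by linarith [(abs_le.1 hCw).1]) (abs_le.1 hCw).2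
        nlinarith [mul_le_mul_of_nonneg_left this (sq_nonneg t)]
    _ = _ := by
        rw [integral_const, Real.coe_toNNReal _ (by positivity)]
        simp

end Population

/-! ### Symmetrization and contraction for exponential moments of finite maxima -/

section OneStep

variable {α : Type*} {T : Finset α} (hT : T.Nonempty)

lemma exp_add_exp_le_of_contraction {a a' h h' u u' : ℝ} (hu : |h| ≤ |u|) (hu' : |h'| ≤ |u'|)
    (hd : |h - h'| ≤ |u - u'|) (hm : a' + h' ≤ a + h) (hm' : a - h ≤ a' - h') :
    Real.exp (a + h) + Real.exp (a' - h') ≤ Real.exp (a + u) + Real.exp (a' - u') ∨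
      Real.exp (a + h) + Real.exp (a' - h') ≤ Real.exp (a - u) + Real.exp (a' + u') := by
  -- `q ↦ exp (q + d) - exp q` is monotone in both `q` and `d ≥ 0`
  have key : ∀ q q' d d' : ℝ, q' ≤ q → d' ≤ d → 0 ≤ d' →
      Real.exp (q' + d') - Real.exp q' ≤ Real.exp (q + d) - Real.exp q := by
    intro q q' d d' hq hdd hd'
    have h1 : Real.exp q' * (Real.exp d' - 1) ≤ Real.exp q * (Real.exp d - 1) :=
      mul_le_mul (Real.exp_le_exp.2 hq) (by linarith [Real.exp_le_exp.2 hdd])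
        (by linarith [Real.one_le_exp hd']) (Real.exp_pos _).le
    rw [Real.exp_add, Real.exp_add]
    linarith
  have hh := abs_le.1 hu
  have hh' := abs_le.1 hu'
  have hdd := abs_le.1 hd
  rcases le_total 0 u with p | p <;> rcases le_total 0 u' with q | q
  · rw [abs_of_nonneg p] at hh
    rw [abs_of_nonneg q] at hh'
    rcases le_total u' u with r | r
    · rw [abs_of_nonneg (sub_nonneg.2 r)] at hdd
      left
      have := key (a + h) (a' - u') (u - h) (u' - h') (by linarith) (by linarith) (by linarith)
      rw [show a + h + (u - h) = a + u by ring, show a' - u' + (u' - h') = a' - h' by ring] at this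
      linarith
    · rw [abs_of_nonpos (sub_nonpos.2 r)] at hdd
      right
      have := key (a' - h') (a - u) (u' + h') (u + h) (by linarith) (by linarith) (by linarith)
      rw [show a' - h' + (u' + h') = a' + u' by ring, show a - u + (u + h) = a + h by ring] at this
      linarith
  · rw [abs_of_nonneg p] at hh
    rw [abs_of_nonpos q] at hh'
    left
    exact add_le_add (Real.exp_le_exp.2 (by linarith)) (Real.exp_le_exp.2 (by linarith))
  · rw [abs_of_nonpos p] at hh
    rw [abs_of_nonneg q] at hh'
    right
    exact add_le_add (Real.exp_le_exp.2 (by linarith)) (Real.exp_le_exp.2 (by linarith))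
  · rw [abs_of_nonpos p] at hh
    rw [abs_of_nonpos q] at hh'
    rcases le_total u' u with r | r
    · rw [abs_of_nonneg (sub_nonneg.2 r)] at hdd
      left
      have := key (a' - h') (a + u) (h' - u') (h - u) (by linarith) (by linarith) (by linarith)
      rw [show a' - h' + (h' - u') = a' - u' by ring, show a + u + (h - u) = a + h by ring] at this
      linarith
    · rw [abs_of_nonpos (sub_nonpos.2 r)] at hdd
      right
      have := key (a + h) (a' + u') (-u - h) (-u' - h') (by linarith) (by linarith) (by linarith)
      rw [show a + h + (-u - h) = a - u by ring, show a' + u' + (-u' - h') = a' - h' by ring]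
        at this
      linarith

/-- The Ledoux–Talagrand comparison for one random sign and the exponential function. -/
lemma exp_sup'_contraction {A h u : α → ℝ} (hu : ∀ t ∈ T, |h t| ≤ |u t|)
    (hd : ∀ t ∈ T, ∀ t' ∈ T, |h t - h t'| ≤ |u t - u t'|) :
    Real.exp (T.sup' hT fun t => A t + h t) + Real.exp (T.sup' hT fun t => A t - h t) ≤
      Real.exp (T.sup' hT fun t => A t + u t) + Real.exp (T.sup' hT fun t => A t - u t) := by
  obtain ⟨t, ht, htm⟩ := T.exists_mem_eq_sup' hT fun t => A t + h t
  obtain ⟨t', ht', htm'⟩ := T.exists_mem_eq_sup' hT fun t => A t - h t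
  have h1 : A t' + h t' ≤ A t + h t := htm ▸ T.le_sup' (fun t => A t + h t) ht'
  have h2 : A t - h t ≤ A t' - h t' := htm' ▸ T.le_sup' (fun t => A t - h t) ht
  rw [htm, htm']
  have hp : ∀ s ∈ T, Real.exp (A s + u s) ≤ Real.exp (T.sup' hT fun t => A t + u t) :=
    fun s hs => Real.exp_le_exp.2 (T.le_sup' (fun t => A t + u t) hs)
  have hn : ∀ s ∈ T, Real.exp (A s - u s) ≤ Real.exp (T.sup' hT fun t => A t - u t) :=
    fun s hs => Real.exp_le_exp.2 (T.le_sup' (fun t => A t - u t) hs)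
  rcases exp_add_exp_le_of_contraction (hu t ht) (hu t' ht') (hd t ht t' ht') h1 h2 with H | H
  · linarith [hp t ht, hn t' ht']
  · linarith [hn t ht, hp t' ht']

variable {S : Type*} [MeasurableSpace S] {P : Measure S} [IsProbabilityMeasure P]

lemma measurable_sup'_fun {γ : Type*} [MeasurableSpace γ] {F : α → γ → ℝ}
    (hF : ∀ t ∈ T, Measurable (F t)) : Measurable fun s => T.sup' hT fun t => F t s := by
  have := Finset.measurable_sup' hT hF
  convert this using 1
  funext s
  rw [Finset.sup'_apply]

/-- Symmetrization of one summand: centring costs a factor two inside the exponential, after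
which both signs are averaged. No independent copy is needed, since the centred maximum is at
most the midpoint of `max (A + 2 g)` and `max (A - 2 E g)`. -/
lemma lintegral_exp_sup'_centered_le {g : α → S → ℝ} {A : α → ℝ} {b : ℝ}
    (hg : ∀ t ∈ T, Measurable (g t)) (hb : ∀ t ∈ T, ∀ᵐ s ∂P, |g t s| ≤ b) :
    ∫⁻ s, ENNReal.ofReal (Real.exp (T.sup' hT fun t => A t + (g t s - ∫ s', g t s' ∂P))) ∂P ≤
      ∫⁻ s, ENNReal.ofReal ((Real.exp (T.sup' hT fun t => A t + 2 * g t s) +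
        Real.exp (T.sup' hT fun t => A t - 2 * g t s)) / 2) ∂P := by
  have hgi : ∀ t ∈ T, Integrable (g t) P := fun t ht =>
    Integrable.of_bound (hg t ht).aestronglyMeasurable b (by simpa using hb t ht)
  have hmp : Measurable fun s => Real.exp (T.sup' hT fun t => A t + 2 * g t s) :=
    (measurable_sup'_fun hT fun t ht => by have := hg t ht; fun_prop).exp
  have hmn : Measurable fun s => Real.exp (T.sup' hT fun t => A t - 2 * g t s) :=
    (measurable_sup'_fun hT fun t ht => by have := hg t ht; fun_prop).exp
  have hpt : ∀ s, ENNReal.ofReal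
      (Real.exp (T.sup' hT fun t => A t + (g t s - ∫ s', g t s' ∂P))) ≤
      ENNReal.ofReal (Real.exp (T.sup' hT fun t => A t + 2 * g t s) / 2) +
        ENNReal.ofReal (Real.exp (T.sup' hT fun t => A t - 2 * ∫ s', g t s' ∂P) / 2) := by
    intro s
    rw [← ENNReal.ofReal_add (by positivity) (by positivity)]
    refine ENNReal.ofReal_le_ofReal ?_
    have h1 : (T.sup' hT fun t => A t + (g t s - ∫ s', g t s' ∂P)) ≤
        (1 / 2 : ℝ) * (T.sup' hT fun t => A t + 2 * g t s) +
          (1 / 2 : ℝ) * (T.sup' hT fun t => A t - 2 * ∫ s', g t s' ∂P) := by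
      refine Finset.sup'_le _ _ fun t ht => ?_
      have h2 := T.le_sup' (fun t => A t + 2 * g t s) ht
      have h3 := T.le_sup' (fun t => A t - 2 * ∫ s', g t s' ∂P) ht
      linarith
    have h4 := convexOn_exp.2 (Set.mem_univ (T.sup' hT fun t => A t + 2 * g t s))
      (Set.mem_univ (T.sup' hT fun t => A t - 2 * ∫ s', g t s' ∂P))
      (by norm_num : (0 : ℝ) ≤ 1 / 2) (by norm_num : (0 : ℝ) ≤ 1 / 2) (by norm_num)
    simp only [smul_eq_mul] at h4
    have := (Real.exp_le_exp.2 h1).trans h4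
    linarith
  have hJ : ENNReal.ofReal (Real.exp (T.sup' hT fun t => A t - 2 * ∫ s', g t s' ∂P) / 2) ≤
      ∫⁻ s, ENNReal.ofReal (Real.exp (T.sup' hT fun t => A t - 2 * g t s) / 2) ∂P := by
    obtain ⟨t, ht, htm⟩ := T.exists_mem_eq_sup' hT fun t => A t - 2 * ∫ s', g t s' ∂P
    have hi1 : Integrable (fun s => A t - 2 * g t s) P :=
      (integrable_const _).sub ((hgi t ht).const_mul 2)
    have hi2 : Integrable (fun s => Real.exp (A t - 2 * g t s)) P := by
      refine Integrable.of_bound (C := Real.exp (A t + 2 * b)) ?_ ?_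
      · have := hg t ht
        exact (by fun_prop : Measurable fun s => Real.exp (A t - 2 * g t s)).aestronglyMeasurable
      · filter_upwards [hb t ht] with s hs
        rw [Real.norm_eq_abs, Real.abs_exp, Real.exp_le_exp]
        linarith [(abs_le.1 hs).1]
    have hj := convexOn_exp.map_integral_le (μ := P) (f := fun s => A t - 2 * g t s)
      Real.continuous_exp.continuousOn isClosed_univ (by simp) hi1 hi2
    rw [integral_sub (integrable_const _) ((hgi t ht).const_mul 2), integral_const_mul] at hj
    simp only [integral_const, probReal_univ, smul_eq_mul, one_mul] at hj
    rw [htm]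
    calc ENNReal.ofReal (Real.exp (A t - 2 * ∫ s', g t s' ∂P) / 2)
        ≤ ENNReal.ofReal (∫ s, Real.exp (A t - 2 * g t s) / 2 ∂P) := by
          rw [integral_div]
          exact ENNReal.ofReal_le_ofReal (by linarith)
      _ = ∫⁻ s, ENNReal.ofReal (Real.exp (A t - 2 * g t s) / 2) ∂P :=
          ofReal_integral_eq_lintegral_ofReal (hi2.div_const 2)
            (ae_of_all _ fun s => by positivity)
      _ ≤ _ := by
          refine lintegral_mono fun s => ENNReal.ofReal_le_ofReal ?_
          have := Real.exp_le_exp.2 (T.le_sup' (fun t => A t - 2 * g t s) ht)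
          linarith
  calc _ ≤ ∫⁻ s, (ENNReal.ofReal (Real.exp (T.sup' hT fun t => A t + 2 * g t s) / 2) +
        ENNReal.ofReal (Real.exp (T.sup' hT fun t => A t - 2 * ∫ s', g t s' ∂P) / 2)) ∂P :=
        lintegral_mono hpt
    _ = ∫⁻ s, ENNReal.ofReal (Real.exp (T.sup' hT fun t => A t + 2 * g t s) / 2) ∂P +
        ENNReal.ofReal (Real.exp (T.sup' hT fun t => A t - 2 * ∫ s', g t s' ∂P) / 2) := by
        rw [lintegral_add_right _ measurable_const]
        simp
    _ ≤ ∫⁻ s, ENNReal.ofReal (Real.exp (T.sup' hT fun t => A t + 2 * g t s) / 2) ∂P +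
        ∫⁻ s, ENNReal.ofReal (Real.exp (T.sup' hT fun t => A t - 2 * g t s) / 2) ∂P := by
        gcongr
    _ = _ := by
        rw [← lintegral_add_left (hmp.div_const 2).ennreal_ofReal]
        refine lintegral_congr fun s => ?_
        rw [← ENNReal.ofReal_add (by positivity) (by positivity), add_div]

end OneStep

/-! ### The empirical process over an `ℓ¹` ball -/

section EmpiricalProcess

variable {ι : Type*} [Fintype ι] {S : Type*} [MeasurableSpace S] {P : Measure S}
  [IsProbabilityMeasure P] {ξ : S → ι → ℝ} {φ : (ι → ℝ) → S → ℝ} {C L r : ℝ}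

lemma exp_sup'_dotProduct_le {T : Finset (ι → ℝ)} (hT : T.Nonempty)
    (hr : ∀ v ∈ T, ∑ j, |v j| ≤ r) (w : ι → ℝ) [Nonempty ι] :
    Real.exp (T.sup' hT fun v => w ⬝ᵥ v) ≤ ∑ j, 2 * Real.cosh (r * w j) := by
  obtain ⟨v, hv, hvm⟩ := T.exists_mem_eq_sup' hT fun v => w ⬝ᵥ v
  obtain ⟨j, -, hj⟩ := Finset.exists_max_image Finset.univ (fun j => |w j|) Finset.univ_nonempty
  have hr0 : 0 ≤ r := (Finset.sum_nonneg fun _ _ => abs_nonneg _).trans (hr v hv)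
  have h1 : w ⬝ᵥ v ≤ |r * w j| := by
    refine (le_abs_self _).trans ((abs_dotProduct_le fun i => hj i (Finset.mem_univ i)).trans ?_)
    rw [abs_mul, abs_of_nonneg hr0, mul_comm]
    exact mul_le_mul_of_nonneg_right (hr v hv) (abs_nonneg _)
  have h2 : Real.exp |r * w j| ≤ 2 * Real.cosh (r * w j) := by
    rw [← Real.cosh_abs, Real.cosh_eq]
    linarith [Real.exp_pos (-|r * w j|)]
  rw [hvm]
  refine ((Real.exp_le_exp.2 h1).trans h2).trans ?_
  exact Finset.single_le_sum (f := fun j => 2 * Real.cosh (r * w j))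
    (fun i _ => by have := Real.cosh_pos (r * w i); positivity) (Finset.mem_univ j)

/-- Exponential moment bound for the maximum of a centred empirical process indexed by finitely
many points of an `ℓ¹` ball and dominated by linear increments. The linear term `w` is what
makes the bound inductive: a symmetrized and contracted summand moves `w` by `± 2 L ξ`. -/
lemma lintegral_exp_sup'_empirical_le [Nonempty ι] {T : Finset (ι → ℝ)} (hT : T.Nonempty)
    (hr : ∀ v ∈ T, ∑ j, |v j| ≤ r) (hξ : Measurable ξ) (hC : ∀ᵐ s ∂P, ∀ j, |ξ s j| ≤ C)
    (hφ : ∀ v, Measurable (φ v)) (hL : 0 ≤ L) (hφ0 : ∀ v s, |φ v s| ≤ L * |ξ s ⬝ᵥ v|)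
    (hφL : ∀ v v' s, |φ v s - φ v' s| ≤ L * |ξ s ⬝ᵥ v - ξ s ⬝ᵥ v'|) (n : ℕ) (w : ι → ℝ) :
    ∫⁻ z, ENNReal.ofReal (Real.exp (T.sup' hT fun v =>
        w ⬝ᵥ v + ∑ i, (φ v (z i) - ∫ s, φ v s ∂P))) ∂(Measure.pi fun _ : Fin n => P) ≤
      ENNReal.ofReal ((∑ j, 2 * Real.cosh (r * w j)) *
        Real.exp (2 * L ^ 2 * r ^ 2 * C ^ 2) ^ n) := by
  induction n generalizing w with
  | zero =>
    simp only [Finset.univ_eq_empty, Finset.sum_empty, add_zero, pow_zero, mul_one, lintegral_const,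
      measure_univ]
    exact ENNReal.ofReal_le_ofReal (exp_sup'_dotProduct_le hT hr w)
  | succ n ih =>
    set Q : Measure (Fin n → S) := Measure.pi fun _ : Fin n => P with hQ
    set m : (ι → ℝ) → ℝ := fun v => ∫ s, φ v s ∂P with hm
    set G : (ι → ℝ) → (Fin n → S) → ℝ := fun v z => ∑ i, (φ v (z i) - m v) with hG
    have hGm : ∀ v, Measurable (G v) := fun v =>
      Finset.measurable_sum _ fun i _ => ((hφ v).comp (measurable_pi_apply i)).sub_const _
    have hdm : ∀ v, Measurable fun s => ξ s ⬝ᵥ v := fun v => by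
      unfold dotProduct
      exact Finset.measurable_sum _ fun j _ =>
        ((measurable_pi_apply j).comp hξ).mul_const _
    have hsplit : ∫⁻ z, ENNReal.ofReal (Real.exp (T.sup' hT fun v =>
        w ⬝ᵥ v + ∑ i, (φ v (z i) - m v))) ∂(Measure.pi fun _ : Fin (n + 1) => P) =
        ∫⁻ z, ∫⁻ s, ENNReal.ofReal (Real.exp (T.sup' hT fun v =>
          (w ⬝ᵥ v + G v z) + (φ v s - m v))) ∂P ∂Q := by
      have hmp := measurePreserving_piFinSuccAbove (fun _ : Fin (n + 1) => P) 0
      have hF : Measurable fun q : S × (Fin n → S) => ENNReal.ofReal (Real.exp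
          (T.sup' hT fun v => (w ⬝ᵥ v + G v q.2) + (φ v q.1 - m v))) := by
        refine (measurable_sup'_fun hT fun v _ => ?_).exp.ennreal_ofReal
        exact (measurable_const.add ((hGm v).comp measurable_snd)).add
          (((hφ v).comp measurable_fst).sub_const _)
      rw [← lintegral_prod_symm _ hF.aemeasurable, ← hmp.lintegral_comp hF]
      refine lintegral_congr fun z => ?_
      congr 2
      refine Finset.sup'_congr hT rfl fun v _ => ?_
      rw [Fin.sum_univ_succ, hG]
      simp only [MeasurableEquiv.piFinSuccAbove_apply, Fin.insertNthEquiv_symm_apply]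
      simp only [Fin.removeNth, Fin.zero_succAbove]
      ring
    have hstep : ∀ z, ∫⁻ s, ENNReal.ofReal (Real.exp (T.sup' hT fun v =>
          (w ⬝ᵥ v + G v z) + (φ v s - m v))) ∂P ≤
        ∫⁻ s, (ENNReal.ofReal (Real.exp (T.sup' hT fun v =>
            (w + (2 * L) • ξ s) ⬝ᵥ v + G v z) / 2) +
          ENNReal.ofReal (Real.exp (T.sup' hT fun v =>
            (w - (2 * L) • ξ s) ⬝ᵥ v + G v z) / 2)) ∂P := by
      intro z
      refine (lintegral_exp_sup'_centered_le hT (b := L * (C * r)) (fun v _ => hφ v)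
        fun v hv => ?_).trans (lintegral_mono fun s => ?_)
      · filter_upwards [hC] with s hs
        refine (hφ0 v s).trans (mul_le_mul_of_nonneg_left ?_ hL)
        refine (abs_dotProduct_le hs).trans ?_
        have : 0 ≤ C := (abs_nonneg _).trans (hs (Classical.arbitrary ι))
        exact mul_le_mul_of_nonneg_left (hr v hv) this
      · rw [← ENNReal.ofReal_add (by positivity) (by positivity), ← add_div]
        refine ENNReal.ofReal_le_ofReal (div_le_div_of_nonneg_right ?_ zero_le_two)
        refine (exp_sup'_contraction hT (u := fun v => 2 * L * (ξ s ⬝ᵥ v)) ?_ ?_).trans (le_of_eq ?_)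
        · intro v _
          rw [abs_mul, abs_mul, abs_mul, abs_of_nonneg hL, abs_two, mul_assoc]
          exact mul_le_mul_of_nonneg_left (hφ0 v s) zero_le_two
        · intro v _ v' _
          rw [← mul_sub, ← mul_sub, abs_mul, abs_mul, abs_mul, abs_of_nonneg hL, abs_two, mul_assoc]
          exact mul_le_mul_of_nonneg_left (hφL v v' s) zero_le_two
        · congr 2 <;> refine Finset.sup'_congr hT rfl fun v _ => ?_
          · simp only [add_dotProduct, smul_dotProduct, smul_eq_mul]; ring
          · simp only [sub_dotProduct, smul_dotProduct, smul_eq_mul]; ring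
    have hmeas : ∀ e : ℝ, Measurable fun q : (Fin n → S) × S => ENNReal.ofReal (Real.exp
        (T.sup' hT fun v => (w + e • ξ q.2) ⬝ᵥ v + G v q.1) / 2) := by
      intro e
      refine ((measurable_sup'_fun hT fun v _ => ?_).exp.div_const 2).ennreal_ofReal
      simp only [add_dotProduct, smul_dotProduct, smul_eq_mul]
      exact (measurable_const.add (((hdm v).comp measurable_snd).const_mul e)).add
        ((hGm v).comp measurable_fst)
    have hmeas' : Measurable fun q : (Fin n → S) × S => ENNReal.ofReal (Real.exp
        (T.sup' hT fun v => (w - (2 * L) • ξ q.2) ⬝ᵥ v + G v q.1) / 2) := by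
      simpa [sub_eq_add_neg] using hmeas (-(2 * L))
    have hih : ∀ w' : ι → ℝ, ∫⁻ z, ENNReal.ofReal (Real.exp (T.sup' hT fun v =>
          w' ⬝ᵥ v + G v z) / 2) ∂Q ≤ ENNReal.ofReal ((∑ j, Real.cosh (r * w' j)) *
        Real.exp (2 * L ^ 2 * r ^ 2 * C ^ 2) ^ n) := by
      intro w'
      have h1 : ∀ z, ENNReal.ofReal (Real.exp (T.sup' hT fun v => w' ⬝ᵥ v + G v z) / 2) =
          ENNReal.ofReal (1 / 2) * ENNReal.ofReal
            (Real.exp (T.sup' hT fun v => w' ⬝ᵥ v + G v z)) := by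
        intro z
        rw [← ENNReal.ofReal_mul (by norm_num)]
        congr 1; ring
      simp_rw [h1]
      rw [lintegral_const_mul' _ _ ENNReal.ofReal_ne_top]
      refine (mul_le_mul_right (ih w') _).trans (le_of_eq ?_)
      rw [← ENNReal.ofReal_mul (by norm_num), ← Finset.mul_sum]
      congr 1; ring
    have hsum : Measurable (Function.uncurry fun (z : Fin n → S) (s : S) =>
        ENNReal.ofReal (Real.exp (T.sup' hT fun v => (w + (2 * L) • ξ s) ⬝ᵥ v + G v z) / 2) +
          ENNReal.ofReal (Real.exp (T.sup' hT fun v =>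
            (w - (2 * L) • ξ s) ⬝ᵥ v + G v z) / 2)) := by
      simp only [Function.uncurry_def]
      exact (hmeas (2 * L)).add hmeas'
    rw [hsplit]
    calc _ ≤ ∫⁻ z, ∫⁻ s, (ENNReal.ofReal (Real.exp (T.sup' hT fun v =>
            (w + (2 * L) • ξ s) ⬝ᵥ v + G v z) / 2) +
          ENNReal.ofReal (Real.exp (T.sup' hT fun v =>
            (w - (2 * L) • ξ s) ⬝ᵥ v + G v z) / 2)) ∂P ∂Q := lintegral_mono hstep
      _ = ∫⁻ s, ∫⁻ z, (ENNReal.ofReal (Real.exp (T.sup' hT fun v =>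
            (w + (2 * L) • ξ s) ⬝ᵥ v + G v z) / 2) +
          ENNReal.ofReal (Real.exp (T.sup' hT fun v =>
            (w - (2 * L) • ξ s) ⬝ᵥ v + G v z) / 2)) ∂Q ∂P :=
          lintegral_lintegral_swap hsum.aemeasurable
      _ ≤ ∫⁻ _, ENNReal.ofReal ((∑ j, 2 * Real.cosh (r * w j)) *
        Real.exp (2 * L ^ 2 * r ^ 2 * C ^ 2) ^ (n + 1)) ∂P := by
          refine lintegral_mono_ae ?_
          filter_upwards [hC] with s hs
          have hms : Measurable fun z => ENNReal.ofReal (Real.exp (T.sup' hT fun v =>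
              (w + (2 * L) • ξ s) ⬝ᵥ v + G v z) / 2) :=
            ((measurable_sup'_fun hT fun v _ =>
              measurable_const.add (hGm v)).exp.div_const 2).ennreal_ofReal
          rw [lintegral_add_left hms]
          refine (add_le_add (hih (w + (2 * L) • ξ s)) (hih (w - (2 * L) • ξ s))).trans ?_
          rw [← ENNReal.ofReal_add
            (mul_nonneg (Finset.sum_nonneg fun _ _ => (Real.cosh_pos _).le) (by positivity))
            (mul_nonneg (Finset.sum_nonneg fun _ _ => (Real.cosh_pos _).le) (by positivity)),
            ← add_mul, ← Finset.sum_add_distrib, pow_succ' (Real.exp _) n, ← mul_assoc]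
          refine ENNReal.ofReal_le_ofReal (mul_le_mul_of_nonneg_right ?_ (by positivity))
          rw [Finset.sum_mul]
          refine Finset.sum_le_sum fun j _ => ?_
          simp only [Pi.add_apply, Pi.sub_apply, Pi.smul_apply, smul_eq_mul, mul_add, mul_sub,
            Real.cosh_add, Real.cosh_sub]
          have h1 : Real.cosh (r * (2 * L * ξ s j)) ≤ Real.exp (2 * L ^ 2 * r ^ 2 * C ^ 2) := by
            refine (Real.cosh_le_exp_half_sq _).trans (Real.exp_le_exp.2 ?_)
            have h2 : ξ s j ^ 2 ≤ C ^ 2 := sq_le_sq' (by linarith [(abs_le.1 (hs j)).1])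
              (abs_le.1 (hs j)).2
            have h3 := mul_le_mul_of_nonneg_left h2 (by positivity : 0 ≤ 2 * L ^ 2 * r ^ 2)
            linarith
          have := mul_le_mul_of_nonneg_left h1 (Real.cosh_pos (r * w j)).le
          linarith
      _ = _ := by simp

/-- Chernoff bound for the maximum of the empirical process over finitely many points. -/
lemma measure_pi_exists_finset_lt_le [Nonempty ι] {n : ℕ} (hn : 0 < n) (T : Finset (ι → ℝ))
    (hr0 : 0 < r) (hr : ∀ v ∈ T, ∑ j, |v j| ≤ r) (hξ : Measurable ξ) (hC0 : 0 < C)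
    (hC : ∀ᵐ s ∂P, ∀ j, |ξ s j| ≤ C) (hφ : ∀ v, Measurable (φ v))
    (hφ0 : ∀ v s, |φ v s| ≤ |ξ s ⬝ᵥ v|)
    (hφL : ∀ v v' s, |φ v s - φ v' s| ≤ |ξ s ⬝ᵥ v - ξ s ⬝ᵥ v'|) {u : ℝ} (hu : 0 ≤ u) :
    (Measure.pi fun _ : Fin n => P)
        {z | ∃ v ∈ T, r * (C * u * √n) < ∑ i, (φ v (z i) - ∫ s, φ v s ∂P)} ≤
      ENNReal.ofReal (2 * Fintype.card ι * Real.exp (-(u ^ 2 / 8))) := by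
  rcases T.eq_empty_or_nonempty with rfl | hT
  · simp
  have hsn : 0 < √(n : ℝ) := Real.sqrt_pos.2 (by exact_mod_cast hn)
  -- the optimal Chernoff parameter
  set a : ℝ := u / (4 * r * C * √n) with ha
  have ha0 : 0 ≤ a := by positivity
  have hexp := lintegral_exp_sup'_empirical_le (φ := fun v s => a * φ v s) (P := P) hT hr hξ hC
    (fun v => (hφ v).const_mul a) ha0
    (fun v s => by
      rw [abs_mul, abs_of_nonneg ha0]; exact mul_le_mul_of_nonneg_left (hφ0 v s) ha0)
    (fun v v' s => by
      rw [← mul_sub, abs_mul, abs_of_nonneg ha0]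
      exact mul_le_mul_of_nonneg_left (hφL v v' s) ha0) n 0
  set F : (Fin n → S) → ENNReal := fun z => ENNReal.ofReal (Real.exp (T.sup' hT fun v =>
    (0 : ι → ℝ) ⬝ᵥ v + ∑ i, (a * φ v (z i) - ∫ s, a * φ v s ∂P))) with hF
  have hFm : Measurable F := by
    refine (measurable_sup'_fun hT fun v _ => ?_).exp.ennreal_ofReal
    exact measurable_const.add (Finset.measurable_sum _ fun i _ =>
      (((hφ v).comp (measurable_pi_apply i)).const_mul a).sub_const _)
  have hsub : {z : Fin n → S | ∃ v ∈ T, r * (C * u * √n) < ∑ i, (φ v (z i) - ∫ s, φ v s ∂P)} ⊆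
      {z | ENNReal.ofReal (Real.exp (a * (r * (C * u * √n)))) ≤ F z} := by
    rintro z ⟨v, hv, hz⟩
    refine ENNReal.ofReal_le_ofReal (Real.exp_le_exp.2 ?_)
    refine le_trans ?_ (T.le_sup' (fun v => (0 : ι → ℝ) ⬝ᵥ v +
      ∑ i, (a * φ v (z i) - ∫ s, a * φ v s ∂P)) hv)
    simp only [zero_dotProduct, zero_add, integral_const_mul, ← mul_sub, ← Finset.mul_sum]
    exact mul_le_mul_of_nonneg_left hz.le ha0
  have hpos : 0 < Real.exp (a * (r * (C * u * √n))) := Real.exp_pos _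
  refine (measure_mono hsub).trans ((meas_ge_le_lintegral_div hFm.aemeasurable
    (by simpa using hpos) ENNReal.ofReal_ne_top).trans ?_)
  rw [ENNReal.div_le_iff (by simpa using hpos) ENNReal.ofReal_ne_top,
    ← ENNReal.ofReal_mul (by positivity)]
  refine hexp.trans (ENNReal.ofReal_le_ofReal ?_)
  rw [← Real.exp_nat_mul, mul_assoc (2 * (Fintype.card ι : ℝ)), ← Real.exp_add]
  simp only [Pi.zero_apply, mul_zero, Real.cosh_zero, mul_one, Finset.sum_const, Finset.card_univ,
    nsmul_eq_mul]
  rw [mul_comm (Fintype.card ι : ℝ) 2]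
  refine mul_le_mul_of_nonneg_left (Real.exp_le_exp.2 (le_of_eq ?_)) (by positivity)
  have h1 : a * (r * (C * u * √n)) = u ^ 2 / 4 := by
    rw [ha]; field_simp
  have h2 : (n : ℝ) * (2 * a ^ 2 * r ^ 2 * C ^ 2) = u ^ 2 / 8 := by
    rw [ha, div_pow, mul_pow, Real.sq_sqrt (Nat.cast_nonneg n)]
    have : (n : ℝ) ≠ 0 := by positivity
    field_simp; ring
  rw [h1, h2]; ring

/-- Uniform deviation of a centred empirical process over the `ℓ¹` ball of radius `r`, from the
finite case by density. Proportionality of the threshold to `r` is what peeling over radii uses. -/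
lemma measure_pi_exists_lt_le [Nonempty ι] {n : ℕ} (hn : 0 < n)
    (hr0 : 0 < r) (hξ : Measurable ξ) (hC0 : 0 < C)
    (hC : ∀ᵐ s ∂P, ∀ j, |ξ s j| ≤ C) (hφ : ∀ v, Measurable (φ v))
    (hφ0 : ∀ v s, |φ v s| ≤ |ξ s ⬝ᵥ v|)
    (hφL : ∀ v v' s, |φ v s - φ v' s| ≤ |ξ s ⬝ᵥ v - ξ s ⬝ᵥ v'|) {u : ℝ} (hu : 0 ≤ u) :
    (Measure.pi fun _ : Fin n => P)
        {z | ∃ v : ι → ℝ, ∑ j, |v j| ≤ r ∧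
          r * (C * u * √n) < ∑ i, (φ v (z i) - ∫ s, φ v s ∂P)} ≤
      ENNReal.ofReal (2 * Fintype.card ι * Real.exp (-(u ^ 2 / 8))) := by
  classical
  -- the process is continuous in `v`, so a countable dense family of indices suffices
  have hcont : ∀ s, Continuous fun v => φ v s := by
    intro s
    refine continuous_iff_continuousAt.2 fun v => ?_
    refine tendsto_iff_dist_tendsto_zero.2 (squeeze_zero
      (g := fun v' => |ξ s ⬝ᵥ v' - ξ s ⬝ᵥ v|) (fun _ => dist_nonneg) (fun v' => hφL v' v s) ?_)
    have : Continuous fun v' => |ξ s ⬝ᵥ v' - ξ s ⬝ᵥ v| := by unfold dotProduct; fun_prop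
    simpa using this.tendsto v
  have hint : ∀ v, Integrable (φ v) P := by
    intro v
    refine Integrable.of_bound (C := C * ∑ j, |v j|) (hφ v).aestronglyMeasurable ?_
    filter_upwards [hC] with s hs
    exact (hφ0 v s).trans (abs_dotProduct_le hs)
  have hcontI : Continuous fun v => ∫ s, φ v s ∂P := by
    refine continuous_iff_continuousAt.2 fun v => ?_
    refine tendsto_iff_dist_tendsto_zero.2 (squeeze_zero (g := fun v' => C * ∑ j, |v' j - v j|)
      (fun _ => dist_nonneg) (fun v' => ?_) ?_)
    · rw [dist_eq_norm, ← integral_sub (hint v') (hint v)]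
      refine (norm_integral_le_of_norm_le_const (C := C * ∑ j, |v' j - v j|) ?_).trans (by simp)
      filter_upwards [hC] with s hs
      refine (hφL v' v s).trans ?_
      rw [← dotProduct_sub]
      exact abs_dotProduct_le hs
    · have : Continuous fun v' : ι → ℝ => C * ∑ j, |v' j - v j| := by fun_prop
      simpa using this.tendsto v
  let B : Type _ := {v : ι → ℝ // ∑ j, |v j| ≤ r}
  have : Nonempty B := ⟨⟨0, by simpa using hr0.le⟩⟩
  set d : ℕ → B := TopologicalSpace.denseSeq B
  set T : ℕ → Finset (ι → ℝ) := fun m => (Finset.range m).image fun l => (d l).1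
  set U : ℕ → Set (Fin n → S) := fun m =>
    {z | ∃ v ∈ T m, r * (C * u * √n) < ∑ i, (φ v (z i) - ∫ s, φ v s ∂P)}
  have hmono : Monotone U := by
    rintro m m' hm z ⟨v, hv, hz⟩
    refine ⟨v, ?_, hz⟩
    exact Finset.image_subset_image (Finset.range_mono hm) hv
  have hsub : {z : Fin n → S | ∃ v : ι → ℝ, ∑ j, |v j| ≤ r ∧
          r * (C * u * √n) < ∑ i, (φ v (z i) - ∫ s, φ v s ∂P)} ⊆ ⋃ m, U m := by
    rintro z ⟨v, hv, hz⟩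
    have hopen : IsOpen {b : B | r * (C * u * √n) < ∑ i, (φ b.1 (z i) - ∫ s, φ b.1 s ∂P)} := by
      refine isOpen_lt continuous_const (continuous_finsetSum _ fun i _ => ?_)
      exact ((hcont _).comp continuous_subtype_val).sub (hcontI.comp continuous_subtype_val)
    obtain ⟨l, hl⟩ := (TopologicalSpace.denseRange_denseSeq B).exists_mem_open hopen ⟨⟨v, hv⟩, hz⟩
    refine Set.mem_iUnion.2 ⟨l + 1, (d l).1, ?_, hl⟩
    exact Finset.mem_image_of_mem _ (Finset.self_mem_range_succ l)
  refine (measure_mono hsub).trans ?_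
  rw [hmono.measure_iUnion]
  refine iSup_le fun m => measure_pi_exists_finset_lt_le hn (T m) hr0 ?_ hξ hC0 hC hφ hφ0 hφL hu
  intro v hv
  obtain ⟨l, -, rfl⟩ := Finset.mem_image.1 hv
  exact (d l).2

end EmpiricalProcess

/-! ### Concentration of the score -/

section Score

variable {Ω : Type*} [MeasurableSpace Ω] {μ : Measure Ω}

lemma lintegral_exp_sq_div_four_gaussianReal_le :
    ∫⁻ g, ENNReal.ofReal (Real.exp (g ^ 2 / 4)) ∂(gaussianReal 0 1) ≤ ENNReal.ofReal √2 := by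
  have h0 : (fun x : ℝ => gaussianPDFReal 0 1 x * Real.exp (x ^ 2 / 4)) =
      fun x => (√(2 * Real.pi))⁻¹ * Real.exp (-(1 / 4) * x ^ 2) := by
    funext x
    rw [gaussianPDFReal, mul_assoc, ← Real.exp_add]
    simp only [NNReal.coe_one, mul_one, sub_zero]
    congr 2
    ring
  rw [gaussianReal_of_var_ne_zero _ one_ne_zero,
    lintegral_withDensity_eq_lintegral_mul _ (measurable_gaussianPDF 0 1) (by fun_prop)]
  simp only [Pi.mul_apply, gaussianPDF,
    ← ENNReal.ofReal_mul (gaussianPDFReal_nonneg 0 1 _)]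
  rw [← ofReal_integral_eq_lintegral_ofReal]
  · rw [h0, integral_const_mul, integral_gaussian]
    refine ENNReal.ofReal_le_ofReal (le_of_eq ?_)
    rw [← Real.sqrt_inv, ← Real.sqrt_mul (by positivity)]
    congr 1
    field_simp
    norm_num
  · rw [h0]
    exact (integrable_exp_neg_mul_sq (by norm_num)).const_mul _
  · exact ae_of_all _ fun x => mul_nonneg (gaussianPDFReal_nonneg 0 1 x) (Real.exp_pos _).le

/-- Square-exponential moment of a sub-Gaussian variable. The square is linearized through
`exp (t² / 2) = E exp (t g)` for a standard Gaussian `g`, and the two integrals are exchanged. -/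
lemma lintegral_exp_sq_div_le [IsFiniteMeasure μ] {Z : Ω → ℝ} {c : NNReal} (hZ : Measurable Z)
    (h : HasSubgaussianMGF Z c μ) (hc : 0 < c) :
    ∫⁻ ω, ENNReal.ofReal (Real.exp (Z ω ^ 2 / (4 * c))) ∂μ ≤ ENNReal.ofReal √2 := by
  set a : ℝ := (√(2 * c))⁻¹ with ha
  have hc' : (0 : ℝ) < c := hc
  have ha2 : a ^ 2 = 1 / (2 * c) := by
    rw [ha, inv_pow, Real.sq_sqrt (by positivity), one_div]
  have hlin : ∀ z : ℝ, ENNReal.ofReal (Real.exp (z ^ 2 / (4 * c))) =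
      ∫⁻ g, ENNReal.ofReal (Real.exp (a * z * g)) ∂(gaussianReal 0 1) := by
    intro z
    rw [← ofReal_integral_eq_lintegral_ofReal (integrable_exp_mul_gaussianReal _)
      (ae_of_all _ fun _ => (Real.exp_pos _).le)]
    have hm := congrFun (mgf_fun_id_gaussianReal (μ := 0) (v := 1)) (a * z)
    rw [mgf] at hm
    rw [hm, mul_pow, ha2]
    congr 2
    push_cast
    field_simp
    ring
  simp_rw [hlin]
  have hmeas : Measurable (Function.uncurry fun (ω : Ω) (g : ℝ) =>
      ENNReal.ofReal (Real.exp (a * Z ω * g))) := by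
    simp only [Function.uncurry_def]
    have := hZ.comp (measurable_fst : Measurable (Prod.fst : Ω × ℝ → Ω))
    exact ((this.const_mul a).mul measurable_snd).exp.ennreal_ofReal
  rw [lintegral_lintegral_swap hmeas.aemeasurable]
  refine le_trans (lintegral_mono fun g => ?_) lintegral_exp_sq_div_four_gaussianReal_le
  have hg : ∀ ω, Real.exp (a * Z ω * g) = Real.exp ((a * g) * Z ω) := fun ω => by ring_nf
  simp_rw [hg]
  rw [← ofReal_integral_eq_lintegral_ofReal (h.integrable_exp_mul _)
      (ae_of_all _ fun _ => (Real.exp_pos _).le)]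
  refine ENNReal.ofReal_le_ofReal ((h.mgf_le (a * g)).trans (Real.exp_le_exp.2 (le_of_eq ?_)))
  rw [mul_pow, ha2]
  field_simp
  ring

/-- Tail bound for the Euclidean norm of a vector of sub-Gaussian variables that may depend on one
another. Convexity of `exp` reduces it to the coordinates with no union bound over them. -/
lemma measure_sum_sq_ge_le [IsFiniteMeasure μ] {K : ℕ} (hK : 0 < K) {Z : Fin K → Ω → ℝ}
    {c : NNReal} (hZ : ∀ k, Measurable (Z k)) (h : ∀ k, HasSubgaussianMGF (Z k) c μ) (hc : 0 < c)
    (q : ℝ) :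
    μ {ω | K * q ≤ ∑ k, Z k ω ^ 2} ≤ ENNReal.ofReal (√2 * Real.exp (-(q / (4 * c)))) := by
  have hc' : (0 : ℝ) < c := hc
  have hK' : (0 : ℝ) < K := by exact_mod_cast hK
  set F : Ω → ENNReal := fun ω => ENNReal.ofReal (∑ k, (1 / K : ℝ) *
    Real.exp (Z k ω ^ 2 / (4 * c))) with hF
  have hFm : Measurable F :=
    (Finset.measurable_sum _ fun k _ =>
      (((hZ k).pow_const 2).div_const _).exp.const_mul _).ennreal_ofReal
  have hFi : ∫⁻ ω, F ω ∂μ ≤ ENNReal.ofReal √2 := by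
    have h1 : ∀ ω, F ω = ∑ k, ENNReal.ofReal (1 / K) *
        ENNReal.ofReal (Real.exp (Z k ω ^ 2 / (4 * c))) := by
      intro ω
      rw [hF]
      simp only
      rw [ENNReal.ofReal_sum_of_nonneg fun _ _ => by positivity]
      exact Finset.sum_congr rfl fun k _ => ENNReal.ofReal_mul (by positivity)
    simp_rw [h1]
    rw [lintegral_finsetSum _ fun k _ =>
      (((hZ k).pow_const 2).div_const _).exp.ennreal_ofReal.const_mul _]
    calc _ ≤ ∑ _k : Fin K, ENNReal.ofReal (1 / K) * ENNReal.ofReal √2 := by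
          refine Finset.sum_le_sum fun k _ => ?_
          rw [lintegral_const_mul' _ _ ENNReal.ofReal_ne_top]
          exact mul_le_mul_right (lintegral_exp_sq_div_le (hZ k) (h k) hc) _
      _ = _ := by
          rw [Finset.sum_const, Finset.card_univ, Fintype.card_fin, nsmul_eq_mul, ← mul_assoc,
            ← ENNReal.ofReal_natCast, ← ENNReal.ofReal_mul hK'.le,
            mul_one_div_cancel hK'.ne', ENNReal.ofReal_one, one_mul]
  have hsub : {ω | K * q ≤ ∑ k, Z k ω ^ 2} ⊆ {ω | ENNReal.ofReal (Real.exp (q / (4 * c))) ≤ F ω} := by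
    intro ω hω
    refine ENNReal.ofReal_le_ofReal ?_
    have hj := convexOn_exp.map_sum_le (t := Finset.univ) (w := fun _ : Fin K => (1 / K : ℝ))
      (p := fun k => Z k ω ^ 2 / (4 * c)) (fun _ _ => by positivity)
      (by simp [hK'.ne']) (fun _ _ => Set.mem_univ _)
    simp only [smul_eq_mul] at hj
    refine le_trans (Real.exp_le_exp.2 ?_) hj
    rw [← Finset.mul_sum, ← Finset.sum_div, ← mul_div_assoc]
    refine div_le_div_of_nonneg_right ?_ (by positivity)
    rw [one_div, inv_mul_eq_div, le_div_iff₀ hK', mul_comm]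
    exact hω
  have hpos : 0 < Real.exp (q / (4 * c)) := Real.exp_pos _
  refine (measure_mono hsub).trans ((meas_ge_le_lintegral_div hFm.aemeasurable
    (by simpa using hpos) ENNReal.ofReal_ne_top).trans ?_)
  rw [ENNReal.div_le_iff (by simpa using hpos) ENNReal.ofReal_ne_top,
    ← ENNReal.ofReal_mul (by positivity), mul_assoc, ← Real.exp_add, neg_add_cancel, Real.exp_zero,
    mul_one]
  exact hFi

/-- The array of score sums `∑ᵢ x_{ij} (τ_k - 1{y_i < x_i ⬝ᵥ β_k})`. -/
def scoreSum {n K p : ℕ} (τ : Fin K → ℝ) (β : Coef K p) (xs : Fin n → Fin (p + 1) → ℝ)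
    (ys : Fin n → ℝ) : Coef K p :=
  fun k j => ∑ i, xs i j * quantileScore (τ k) (ys i - xs i ⬝ᵥ β k)

variable [IsProbabilityMeasure μ] {n K p : ℕ} {x : Fin n → Ω → Fin (p + 1) → ℝ}
  {y : Fin n → Ω → ℝ} {τ : Fin K → ℝ} {β : Coef K p} {Cx : ℝ}

lemma tuning_eq (hK : 0 ≤ (K : ℝ)) (hn : 0 ≤ (n : ℝ)) (D₂ : ℝ) :
    tuning n K p Cx D₂ = Cx * √K / √n * (1 + 2 * √(D₂ * Real.log p)) := by
  rw [tuning, Real.sqrt_div hK, Real.sqrt_div' _ hn,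
    show D₂ * K * Real.log p = K * (D₂ * Real.log p) by ring, Real.sqrt_mul hK]
  ring

/-- The tuning parameter dominates twice the averaged score of a predictor. The square of
`1 / 2 + √(D₂ log p)` in the exponent exceeds `D₂ log p` by enough to absorb the factor `√2` of the
square-exponential moment. -/
lemma measure_groupNorm_scoreSum_gt_le (hn : 0 < n) (hK : 0 < K) (hp : 0 < p)
    (hM : Model μ x y τ β) (hC : BoundedCovariates μ x Cx) {D₂ : ℝ}
    (hD : 1 / 16 ≤ D₂ * Real.log p) (j : Fin (p + 1)) :
    μ {ω | n * (tuning n K p Cx D₂ / 2) <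
        groupNorm (scoreSum τ β (fun i => x i ω) (fun i => y i ω)) j} ≤
      ENNReal.ofReal ((p : ℝ) ^ (-D₂)) := by
  obtain ⟨hC0, hCb⟩ := hC
  have hn' : (0 : ℝ) < n := by exact_mod_cast hn
  have hK' : (0 : ℝ) < K := by exact_mod_cast hK
  have hscore : ∀ k, Measurable fun z : (Fin (p + 1) → ℝ) × ℝ =>
      z.1 j * quantileScore (τ k) (z.2 - z.1 ⬝ᵥ β k) := by
    intro k
    have h1 : Measurable fun z : (Fin (p + 1) → ℝ) × ℝ =>
        quantileScore (τ k) (z.2 - z.1 ⬝ᵥ β k) :=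
      (measurable_quantileScore _).comp
        (measurable_snd.sub ((measurable_dotProduct_left _).comp measurable_fst))
    fun_prop
  have hxy : ∀ i, Measurable fun ω => (x i ω, y i ω) := fun i =>
    (hM.measurable_x i).prodMk (hM.measurable_y i)
  set c : NNReal := ∑ _i : Fin n, Real.toNNReal (Cx ^ 2 / 4) with hc
  have hcv : (c : ℝ) = n * (Cx ^ 2 / 4) := by
    rw [hc, Finset.sum_const, Finset.card_univ, Fintype.card_fin, nsmul_eq_mul]
    push_cast
    rw [Real.coe_toNNReal _ (by positivity)]
  have hc0 : 0 < c := by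
    rw [← NNReal.coe_pos, hcv]; positivity
  have hsub : ∀ k, HasSubgaussianMGF (fun ω => scoreSum τ β (fun i => x i ω) (fun i => y i ω) k j)
      c μ := by
    intro k
    refine HasSubgaussianMGF.sum_of_iIndepFun
      (X := fun i ω => x i ω j * quantileScore (τ k) (y i ω - x i ω ⬝ᵥ β k))
      (hM.indep.comp (fun _ z => z.1 j * quantileScore (τ k) (z.2 - z.1 ⬝ᵥ β k))
        fun _ => hscore k) fun i _ => ?_
    refine hasSubgaussianMGF_score (hM.measurable_x i) (hM.measurable_y i) (hM.level_mem k) ?_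
      (hM.quantile i k) j
    filter_upwards [hCb] with ω hω j' using (hω i j').le
  have hmeas : ∀ k, Measurable
      fun ω => scoreSum τ β (fun i => x i ω) (fun i => y i ω) k j := fun k =>
    Finset.measurable_sum _ fun i _ => (hscore k).comp (hxy i)
  set l : ℝ := √(D₂ * Real.log p) with hl
  have hl2 : l ^ 2 = D₂ * Real.log p := Real.sq_sqrt (by linarith)
  have hl0 : 1 / 4 ≤ l := Real.le_sqrt_of_sq_le (by norm_num; linarith)
  have key := measure_sum_sq_ge_le (μ := μ) hK hmeas hsub hc0 (n * Cx ^ 2 * (1 / 2 + l) ^ 2)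
  refine (measure_mono fun ω hω => ?_).trans (key.trans (ENNReal.ofReal_le_ofReal ?_))
  · simp only [Set.mem_ofPred_eq] at hω ⊢
    have h1 : 0 ≤ (n : ℝ) * (tuning n K p Cx D₂ / 2) := by
      rw [tuning_eq hK'.le hn'.le]; positivity
    have h2 := pow_le_pow_left₀ h1 hω.le 2
    rw [groupNorm, l2norm_sq] at h2
    refine le_trans (le_of_eq ?_) h2
    rw [tuning_eq hK'.le hn'.le, ← hl]
    simp only [mul_pow, div_pow, Real.sq_sqrt hK'.le, Real.sq_sqrt hn'.le]
    field_simp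
  · have h1 : n * Cx ^ 2 * (1 / 2 + l) ^ 2 / (4 * (c : ℝ)) = (1 / 4 + l) + D₂ * Real.log p := by
      rw [hcv, ← hl2]; field_simp; ring
    rw [h1, neg_add, Real.exp_add, ← mul_assoc,
      show -(D₂ * Real.log p) = Real.log p * -D₂ by ring,
      ← Real.rpow_def_of_pos (by exact_mod_cast hp)]
    refine mul_le_of_le_one_left (by positivity) ?_
    rw [Real.exp_neg, mul_inv_le_iff₀ (Real.exp_pos _), one_mul]
    have h2 : √2 ≤ 3 / 2 := Real.sqrt_le_iff.2 ⟨by norm_num, by norm_num⟩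
    linarith [Real.add_one_le_exp (1 / 4 + l)]

end Score

/-! ### The basic inequality and the cone -/

section Deterministic

variable {n K p : ℕ} {τ : Fin K → ℝ} {lam : ℝ} {xs : Fin n → Fin (p + 1) → ℝ} {ys : Fin n → ℝ}
  {β Δ : Coef K p}

lemma convexOn_objective (hlam : 0 ≤ lam) :
    ConvexOn ℝ Set.univ (objective τ lam xs ys : Coef K p → ℝ) := by
  have hloss : ∀ k i, ConvexOn ℝ Set.univ
      fun b : Coef K p => checkLoss (τ k) (ys i - xs i ⬝ᵥ b k) := by
    intro k i
    refine ⟨convex_univ, fun b _ b' _ s t hs ht hst => ?_⟩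
    have := (convexOn_checkLoss (τ k)).2 (Set.mem_univ (ys i - xs i ⬝ᵥ b k))
      (Set.mem_univ (ys i - xs i ⬝ᵥ b' k)) hs ht hst
    refine le_trans (le_of_eq (congrArg (checkLoss (τ k)) ?_)) this
    simp only [Pi.add_apply, Pi.smul_apply, dotProduct_add, dotProduct_smul, smul_eq_mul]
    linear_combination (-ys i) * hst
  have hgroup : ∀ j, ConvexOn ℝ Set.univ fun b : Coef K p => groupNorm b j := by
    intro j
    refine ⟨convex_univ, fun b _ b' _ s t hs ht _ => ?_⟩
    refine (groupNorm_add_le _ _ _).trans ?_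
    rw [groupNorm_smul, groupNorm_smul, abs_of_nonneg hs, abs_of_nonneg ht]
    rfl
  have hsum : ∀ {γ : Type} (s : Finset γ) (f : γ → Coef K p → ℝ),
      (∀ t, ConvexOn ℝ Set.univ (f t)) → ConvexOn ℝ Set.univ fun b => ∑ t ∈ s, f t b := by
    intro γ s f hf
    classical
    induction s using Finset.induction_on with
    | empty => simpa using convexOn_const (0 : ℝ) convex_univ
    | insert t s ht ih =>
      simp only [Finset.sum_insert ht]
      exact (hf t).add ih
  have h1 := (hsum Finset.univ _ fun k => hsum Finset.univ _ (hloss k)).smul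
    (by positivity : (0 : ℝ) ≤ 1 / n)
  have h2 := (hsum Finset.univ _ fun j : Fin p => hgroup j.succ).smul hlam
  exact h1.add h2

lemma sum_succ_eq (β : Coef K p) (f : Fin (p + 1) → ℝ) :
    ∑ j : Fin p, f j.succ = ∑ j ∈ activeSet β, f j + ∑ j ∈ (activeSetBar β)ᶜ, f j := by
  classical
  have h0 : (0 : Fin (p + 1)) ∉ activeSet β := by simp [activeSet]
  have h1 := Finset.sum_add_sum_compl (activeSetBar β) f
  have h2 : ∑ j ∈ activeSetBar β, f j = f 0 + ∑ j ∈ activeSet β, f j := by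
    rw [activeSetBar, Finset.sum_insert h0]
  rw [Fin.sum_univ_succ] at h1
  linarith

lemma penalty_sub_ge (β Δ : Coef K p) :
    ∑ j ∈ (activeSetBar β)ᶜ, groupNorm Δ j - ∑ j ∈ activeSet β, groupNorm Δ j ≤
      ∑ j : Fin p, groupNorm (β + Δ) j.succ - ∑ j : Fin p, groupNorm β j.succ := by
  classical
  have h1 : ∀ j ∈ (activeSetBar β)ᶜ, groupNorm Δ j ≤ groupNorm (β + Δ) j - groupNorm β j := by
    intro j hj
    have hj' : groupNorm β j = 0 := by
      by_contra h
      simp only [activeSetBar, activeSet, Finset.mem_compl, Finset.mem_insert, Finset.mem_filter,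
        Finset.mem_univ, true_and, not_or, not_and] at hj
      exact hj.2 hj.1 h
    have h2 : (fun k => β k j) = 0 := l2norm_eq_zero.1 hj'
    have h3 : (fun k => (β + Δ) k j) = fun k => Δ k j := by
      funext k
      have := congrFun h2 k
      simp only [Pi.zero_apply] at this
      simp [this]
    rw [hj', sub_zero, groupNorm, groupNorm, h3]
  have h2 : ∀ j ∈ activeSet β, -groupNorm Δ j ≤ groupNorm (β + Δ) j - groupNorm β j := by
    intro j _
    have := groupNorm_add_le (β + Δ) ((-1 : ℝ) • Δ) j
    rw [groupNorm_smul, show β + Δ + (-1 : ℝ) • Δ = β by simp] at this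
    norm_num at this
    linarith
  have h3 := Finset.sum_le_sum h1
  have h4 := Finset.sum_le_sum h2
  rw [Finset.sum_sub_distrib] at h3 h4
  rw [Finset.sum_neg_distrib] at h4
  rw [sum_succ_eq β, sum_succ_eq β]
  linarith

lemma objective_add_sub (β Δ : Coef K p) :
    objective τ lam xs ys (β + Δ) - objective τ lam xs ys β =
      1 / (n : ℝ) * ∑ k, ∑ i, lossDiff (τ k) (β k) (Δ k) (xs i, ys i) +
        lam * (∑ j : Fin p, groupNorm (β + Δ) j.succ - ∑ j : Fin p, groupNorm β j.succ) := by
  simp only [objective, lossDiff, Finset.sum_sub_distrib, Pi.add_apply, dotProduct_add, sub_sub]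
  ring

lemma sum_lossDiff_ge (β Δ : Coef K p) :
    -∑ j, groupNorm Δ j * groupNorm (scoreSum τ β xs ys) j ≤
      ∑ k, ∑ i, lossDiff (τ k) (β k) (Δ k) (xs i, ys i) := by
  have h1 : ∑ k, ∑ i, (xs i ⬝ᵥ Δ k) * quantileScore (τ k) (ys i - xs i ⬝ᵥ β k) =
      ∑ j, ∑ k, Δ k j * scoreSum τ β xs ys k j := by
    rw [Finset.sum_comm (s := (Finset.univ : Finset (Fin (p + 1))))]
    refine Finset.sum_congr rfl fun k _ => ?_
    simp only [scoreSum, dotProduct, Finset.sum_mul, Finset.mul_sum]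
    rw [Finset.sum_comm]
    refine Finset.sum_congr rfl fun j _ => Finset.sum_congr rfl fun i _ => ?_
    ring
  have h2 : ∑ j, ∑ k, Δ k j * scoreSum τ β xs ys k j ≤
      ∑ j, groupNorm Δ j * groupNorm (scoreSum τ β xs ys) j :=
    Finset.sum_le_sum fun j _ => sum_mul_le_l2norm _ _
  have h3 : 0 ≤ ∑ k, ∑ i, (lossDiff (τ k) (β k) (Δ k) (xs i, ys i) +
      (xs i ⬝ᵥ Δ k) * quantileScore (τ k) (ys i - xs i ⬝ᵥ β k)) :=
    Finset.sum_nonneg fun k _ => Finset.sum_nonneg fun i _ => checkLoss_remainder_nonneg _ _ _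
  simp only [Finset.sum_add_distrib] at h3
  linarith

lemma mem_cone_of_objective_le (hn : 0 < n) (hlam : 0 < lam)
    (hobj : objective τ lam xs ys (β + Δ) ≤ objective τ lam xs ys β)
    (hscore : ∀ j, groupNorm (scoreSum τ β xs ys) j ≤ n * (lam / 2)) : Δ ∈ cone β := by
  classical
  have hn' : (0 : ℝ) < n := by exact_mod_cast hn
  have h1 := objective_add_sub (τ := τ) (lam := lam) (xs := xs) (ys := ys) β Δ
  have h2 := mul_le_mul_of_nonneg_left (penalty_sub_ge β Δ) hlam.le
  have h3 : -(lam / 2 * ∑ j, groupNorm Δ j) ≤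
      1 / (n : ℝ) * ∑ k, ∑ i, lossDiff (τ k) (β k) (Δ k) (xs i, ys i) := by
    have h4 : ∑ j, groupNorm Δ j * groupNorm (scoreSum τ β xs ys) j ≤
        n * (lam / 2 * ∑ j, groupNorm Δ j) := by
      rw [← mul_assoc, Finset.mul_sum]
      refine Finset.sum_le_sum fun j _ => ?_
      rw [mul_comm]
      exact mul_le_mul_of_nonneg_right (hscore j) (groupNorm_nonneg _ _)
    rw [one_div, inv_mul_eq_div, le_div_iff₀ hn']
    have := sum_lossDiff_ge (τ := τ) (xs := xs) (ys := ys) β Δ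
    linarith
  have h5 := Finset.sum_add_sum_compl (activeSetBar β) fun j => groupNorm Δ j
  have h6 : ∑ j ∈ activeSet β, groupNorm Δ j ≤ ∑ j ∈ activeSetBar β, groupNorm Δ j :=
    Finset.sum_le_sum_of_subset_of_nonneg (Finset.subset_insert _ _)
      fun _ _ _ => groupNorm_nonneg _ _
  have h7 : lam * ∑ j ∈ (activeSetBar β)ᶜ, groupNorm Δ j ≤
      lam * (3 * ∑ j ∈ activeSetBar β, groupNorm Δ j) := by
    have h8 := mul_le_mul_of_nonneg_left h6 hlam.le
    rw [← h5] at h3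
    linarith
  exact le_of_mul_le_mul_left h7 hlam

lemma sum_abs_le_of_mem_cone (hΔ : Δ ∈ cone β) :
    ∑ k, ∑ j, |Δ k j| ≤ 4 * √K * √((activeSet β).card + 1) * coefNorm Δ := by
  classical
  have h0 : (0 : Fin (p + 1)) ∉ activeSet β := by simp [activeSet]
  have h1 := Finset.sum_add_sum_compl (activeSetBar β) fun j => groupNorm Δ j
  have h2 := sum_groupNorm_le Δ (activeSetBar β)
  rw [activeSetBar, Finset.card_insert_of_notMem h0, ← activeSetBar] at h2
  push_cast at h2
  have h3 : ∑ j, groupNorm Δ j ≤ 4 * (√((activeSet β).card + 1) * coefNorm Δ) := by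
    have : ∑ j ∈ (activeSetBar β)ᶜ, groupNorm Δ j ≤
      3 * ∑ j ∈ activeSetBar β, groupNorm Δ j := hΔ
    linarith
  refine (sum_abs_le_sqrt_mul_sum_groupNorm Δ).trans ?_
  have := mul_le_mul_of_nonneg_left h3 (Real.sqrt_nonneg K)
  linarith

lemma average_lossDiff_le (hlam : 0 ≤ lam)
    (hobj : objective τ lam xs ys (β + Δ) ≤ objective τ lam xs ys β) :
    1 / (n : ℝ) * ∑ k, ∑ i, lossDiff (τ k) (β k) (Δ k) (xs i, ys i) ≤
      lam * (√(activeSet β).card * coefNorm Δ) := by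
  have h1 := objective_add_sub (τ := τ) (lam := lam) (xs := xs) (ys := ys) β Δ
  have h2 := mul_le_mul_of_nonneg_left (penalty_sub_ge β Δ) hlam
  have h3 := mul_le_mul_of_nonneg_left (sum_groupNorm_le Δ (activeSet β)) hlam
  have h4 : 0 ≤ lam * ∑ j ∈ (activeSetBar β)ᶜ, groupNorm Δ j :=
    mul_nonneg hlam (Finset.sum_nonneg fun _ _ => groupNorm_nonneg _ _)
  linarith

/-- An estimate at distance more than `R` from `β` produces, on the segment towards `β`, an array
at distance exactly `R` whose objective does not exceed that of `β`. -/
lemma exists_coefNorm_eq_of_isEstimate (hlam : 0 ≤ lam) {βhat : Coef K p} {R : ℝ} (hR : 0 < R)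
    (hest : IsEstimate τ lam xs ys βhat) (hfar : R < coefNorm (βhat - β)) :
    ∃ Δ : Coef K p, coefNorm Δ = R ∧
      objective τ lam xs ys (β + Δ) ≤ objective τ lam xs ys β := by
  have hN : 0 < coefNorm (βhat - β) := hR.trans hfar
  set t : ℝ := R / coefNorm (βhat - β) with ht
  have ht0 : 0 ≤ t := by positivity
  have ht1 : t ≤ 1 := (div_le_one hN).2 hfar.le
  refine ⟨t • (βhat - β), ?_, ?_⟩
  · rw [coefNorm_smul, abs_of_nonneg ht0, ht, div_mul_cancel₀ _ hN.ne']
  · have h1 := (convexOn_objective (τ := τ) (xs := xs) (ys := ys) hlam).2 (Set.mem_univ β)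
      (Set.mem_univ βhat) (sub_nonneg.2 ht1) ht0 (by ring)
    rw [show β + t • (βhat - β) = (1 - t) • β + t • βhat by module]
    refine h1.trans ?_
    simp only [smul_eq_mul]
    have := mul_le_mul_of_nonneg_left (hest β) ht0
    linarith

/-- Dyadic peeling: bounds on the balls of radius `M / 2 ^ l`, one constant `t` per unit of
radius, add up over the blocks to `3 M t` when the block radii sum to at most `M`. -/
lemma sum_le_three_mul_of_dyadic {ι : Type*} {N : ι → ℝ} {G : Fin K → ι → ℝ} {M t : ℝ}
    (hK : 0 < K) (hM : 0 ≤ M) (ht : 0 ≤ t) (hN : ∀ v, 0 ≤ N v)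
    (hG : ∀ k, ∀ l < K, ∀ v, N v ≤ M / 2 ^ l → G k v ≤ M / 2 ^ l * t) {v : Fin K → ι}
    (hv : ∑ k, N (v k) ≤ M) : ∑ k, G k (v k) ≤ 3 * M * t := by
  have hK' : (0 : ℝ) < K := by exact_mod_cast hK
  have hlevel : ∀ a : ℝ, a ≤ M → ∀ m : ℕ, ∃ l ≤ m, a ≤ M / 2 ^ l ∧ (M / 2 ^ l ≤ 2 * a ∨ l = m) := by
    intro a ha m
    induction m with
    | zero => exact ⟨0, le_rfl, by simpa using ha, Or.inr rfl⟩
    | succ m ih =>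
      obtain ⟨l, hl, h1, h2⟩ := ih
      rcases h2 with h2 | rfl
      · exact ⟨l, hl.trans (Nat.le_succ m), h1, Or.inl h2⟩
      · by_cases h3 : a ≤ M / 2 ^ (l + 1)
        · exact ⟨l + 1, le_rfl, h3, Or.inr rfl⟩
        · refine ⟨l, Nat.le_succ l, h1, Or.inl ?_⟩
          rw [pow_succ, ← div_div] at h3
          linarith
  have hk : ∀ k, G k (v k) ≤ (2 * N (v k) + M / K) * t := by
    intro k
    have hle : N (v k) ≤ M :=
      (Finset.single_le_sum (f := fun k => N (v k)) (fun _ _ => hN _) (Finset.mem_univ k)).trans hv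
    obtain ⟨l, hl, h1, h2⟩ := hlevel _ hle (K - 1)
    refine (hG k l (by omega) _ h1).trans (mul_le_mul_of_nonneg_right ?_ ht)
    rcases h2 with h2 | rfl
    · have : 0 ≤ M / K := by positivity
      linarith
    · have h3 : (K : ℝ) ≤ 2 ^ (K - 1) := by
        have := Nat.lt_two_pow_self (n := K - 1)
        have h4 : K ≤ 2 ^ (K - 1) := by omega
        exact_mod_cast h4
      have := div_le_div_of_nonneg_left hM hK' h3
      linarith [hN (v k)]
  refine (Finset.sum_le_sum fun k _ => hk k).trans ?_
  rw [← Finset.sum_mul, Finset.sum_add_distrib, ← Finset.mul_sum, Finset.sum_const,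
    Finset.card_univ, Fintype.card_fin, nsmul_eq_mul, mul_div_cancel₀ _ hK'.ne']
  exact mul_le_mul_of_nonneg_right (by linarith) ht

end Deterministic

/-! ### Restricted strong convexity of the expected loss -/

section RestrictedConvexity

variable {Ω : Type*} [MeasurableSpace Ω] {μ : Measure Ω} [IsProbabilityMeasure μ] {n K p : ℕ}
  {x : Fin n → Ω → Fin (p + 1) → ℝ} {y : Fin n → Ω → ℝ} {τ : Fin K → ℝ} {β Δ : Coef K p}
  {c₁ c₂ Cx bt Bt dt : ℝ} {b B : Fin K → ℝ}

lemma dotProduct_secondMoment_mulVec {X : Ω → Fin (p + 1) → ℝ} (hX : Measurable X) {C : ℝ}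
    (hC : ∀ᵐ ω ∂μ, ∀ j, |X ω j| ≤ C) (v : Fin (p + 1) → ℝ) :
    v ⬝ᵥ (secondMoment μ X *ᵥ v) = ∫ ω, (X ω ⬝ᵥ v) ^ 2 ∂μ := by
  have hi : ∀ j l, Integrable (fun ω => X ω j * X ω l) μ := by
    intro j l
    refine Integrable.of_bound (C := C * C)
      (((measurable_pi_apply j).comp hX).mul ((measurable_pi_apply l).comp hX)).aestronglyMeasurable
      ?_
    filter_upwards [hC] with ω hω
    rw [norm_mul]
    exact mul_le_mul (hω j) (hω l) (norm_nonneg _) ((abs_nonneg _).trans (hω j))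
  have h1 : ∀ ω, (X ω ⬝ᵥ v) ^ 2 = ∑ j, ∑ l, v j * v l * (X ω j * X ω l) := by
    intro ω
    rw [sq, dotProduct, Finset.sum_mul_sum]
    exact Finset.sum_congr rfl fun j _ => Finset.sum_congr rfl fun l _ => by ring
  simp_rw [h1]
  rw [integral_finsetSum _ fun j _ => integrable_finsetSum _ fun l _ => (hi j l).const_mul _]
  simp only [dotProduct, mulVec, secondMoment, Matrix.of_apply, Finset.mul_sum]
  refine Finset.sum_congr rfl fun j _ => ?_
  rw [integral_finsetSum _ fun l _ => (hi j l).const_mul _]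
  refine Finset.sum_congr rfl fun l _ => ?_
  rw [integral_const_mul]
  ring

/-- In the cone, the expected loss of each block is quadratically minorized up to radius `dt`: the
restricted nonlinearity constant bounds the cubic term of the Taylor expansion by a third of the
quadratic one. -/
lemma integral_lossDiff_ge_of_mem_cone (hM : Model μ x y τ β)
    (hD : DensityCondition μ x y β c₁ c₂) (hC : BoundedCovariates μ x Cx)
    (hE : EigenvalueCondition μ x β b B bt Bt) (hN : NonlinearityCondition μ x β c₁ c₂ B dt)
    (hΔ : Δ ∈ cone β) (i : Fin n) (k : Fin K) (hdt : l2norm (Δ k) ≤ dt) :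
    c₁ * bt / 3 * l2norm (Δ k) ^ 2 ≤ ∫ ω, lossDiff (τ k) (β k) (Δ k) (x i ω, y i ω) ∂μ := by
  obtain ⟨hc₁, hc₂, hdens⟩ := hD
  obtain ⟨hbt, -, hbB, hev⟩ := hE
  obtain ⟨hb, hB, hbtb, -⟩ := hbB k
  obtain ⟨hdt0, hdk⟩ := hN
  have hCi : ∀ᵐ ω ∂μ, ∀ j, |x i ω j| ≤ Cx := by
    filter_upwards [hC.2] with ω hω j using (hω i j).le
  by_cases h0 : l2norm (Δ k) = 0
  · have : Δ k = 0 := l2norm_eq_zero.1 h0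
    rw [h0, this]
    simp
  have hpos : 0 < l2norm (Δ k) := lt_of_le_of_ne (l2norm_nonneg _) (Ne.symm h0)
  have hlow := integral_lossDiff_ge (c₁ := c₁) (c₂ := c₂) (hM.measurable_x i) (hM.measurable_y i)
    (hM.level_mem k) hCi (hM.quantile i k) (by
      filter_upwards [hdens i] with w hw
      obtain ⟨f, h1, h2, h3, h4, h5⟩ := hw
      exact ⟨f, h1, h2, h3, h4 k, h5⟩) (Δ k)
  set E₂ := ∫ ω, (x i ω ⬝ᵥ Δ k) ^ 2 ∂μ with hE₂
  set E₃ := ∫ ω, |x i ω ⬝ᵥ Δ k| ^ 3 ∂μ with hE₃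
  obtain ⟨hq1, hq2⟩ := hev i k (Δ k) ⟨Δ, hΔ, rfl⟩
  rw [dotProduct_secondMoment_mulVec (hM.measurable_x i) hCi, ← hE₂] at hq1 hq2
  have hE₂0 : 0 < E₂ := lt_of_lt_of_le (by positivity) hq1
  have hE₃n : 0 ≤ E₃ := integral_nonneg fun ω => by positivity
  have hratio : dt ≤ c₁ / (c₂ * √(B k)) * (E₂ ^ (3 / 2 : ℝ) / E₃) := by
    refine (hdk i k).trans (mul_le_mul_of_nonneg_left ?_ (by positivity))
    refine csInf_le ⟨0, ?_⟩ ⟨Δ, ⟨hΔ, h0⟩, rfl⟩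
    rintro _ ⟨Δ', -, rfl⟩
    exact div_nonneg (Real.rpow_nonneg (integral_nonneg fun ω => sq_nonneg _) _)
      (integral_nonneg fun ω => by positivity)
  -- the ratio would be the junk value `0` if the third moment vanished
  have hE₃0 : 0 < E₃ := by
    refine lt_of_le_of_ne hE₃n fun h => ?_
    rw [← h, div_zero, mul_zero] at hratio
    linarith
  have hE₂pow : E₂ ^ (3 / 2 : ℝ) ≤ E₂ * (√(B k) * l2norm (Δ k)) := by
    rw [show (3 / 2 : ℝ) = 1 + 1 / 2 by norm_num, Real.rpow_add hE₂0, Real.rpow_one,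
      ← Real.sqrt_eq_rpow]
    refine mul_le_mul_of_nonneg_left ?_ hE₂0.le
    rw [← Real.sqrt_sq hpos.le, ← Real.sqrt_mul hB.le]
    exact Real.sqrt_le_sqrt hq2
  have hsB : 0 < √(B k) := Real.sqrt_pos.2 hB
  have hcmp : c₂ * E₃ ≤ c₁ * E₂ := by
    rw [div_mul_div_comm, le_div_iff₀ (by positivity)] at hratio
    have h1 : dt * (c₂ * √(B k) * E₃) ≤ c₁ * (E₂ * (√(B k) * dt)) := by
      refine hratio.trans (mul_le_mul_of_nonneg_left (hE₂pow.trans ?_) hc₁.le)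
      gcongr
    have h2 : (dt * √(B k)) * (c₂ * E₃) ≤ (dt * √(B k)) * (c₁ * E₂) := by linarith
    exact le_of_mul_le_mul_left h2 (by positivity)
  refine le_trans ?_ hlow
  have h3 : bt * l2norm (Δ k) ^ 2 ≤ E₂ :=
    (mul_le_mul_of_nonneg_right hbtb (sq_nonneg _)).trans hq1
  have h4 := mul_le_mul_of_nonneg_left h3 hc₁.le
  linarith

end RestrictedConvexity

/-! ### Probability of the good event and the error bound -/

section Assembly

variable {Ω : Type*} [MeasurableSpace Ω] {μ : Measure Ω} [IsProbabilityMeasure μ] {n K p : ℕ}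
  {x : Fin n → Ω → Fin (p + 1) → ℝ} {y : Fin n → Ω → ℝ} {τ : Fin K → ℝ} {β : Coef K p}
  {c₁ c₂ Cx bt Bt dt D₁ D₂ Cstar : ℝ} {b B : Fin K → ℝ}

lemma measure_empirical_lossDiff_gt_le (hM : Model μ x y τ β) (hC : BoundedCovariates μ x Cx)
    (i₀ : Fin n) (k : Fin K) {r u : ℝ} (hr : 0 < r) (hu : 0 ≤ u) :
    μ {ω | ∃ v : Fin (p + 1) → ℝ, ∑ j, |v j| ≤ r ∧ r * (Cx * u * √n) <
        ∑ i, ((∫ ω', lossDiff (τ k) (β k) v (x i₀ ω', y i₀ ω') ∂μ) -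
          lossDiff (τ k) (β k) v (x i ω, y i ω))} ≤
      ENNReal.ofReal (2 * (p + 1) * Real.exp (-(u ^ 2 / 8))) := by
  have hxy : ∀ i, Measurable fun ω => (x i ω, y i ω) := fun i =>
    (hM.measurable_x i).prodMk (hM.measurable_y i)
  set P : Measure ((Fin (p + 1) → ℝ) × ℝ) := μ.map fun ω => (x i₀ ω, y i₀ ω) with hP
  have hPprob : IsProbabilityMeasure P := Measure.isProbabilityMeasure_map (hxy i₀).aemeasurable
  have hjoint : μ.map (fun ω i => (x i ω, y i ω)) = Measure.pi fun _ => P := by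
    rw [(iIndepFun_iff_map_fun_eq_pi_map fun i => (hxy i).aemeasurable).1 hM.indep]
    congr 1
    funext i
    exact (hM.ident i i₀).map_eq
  have hPC : ∀ᵐ s ∂P, ∀ j, |s.1 j| ≤ Cx := by
    rw [hP, ae_map_iff (hxy i₀).aemeasurable]
    · filter_upwards [hC.2] with ω hω j using (hω i₀ j).le
    · rw [Set.ofPred_forall]
      exact MeasurableSet.iInter fun j => measurableSet_le
        ((measurable_pi_apply j).comp measurable_fst).abs measurable_const
  have hint : ∀ v, ∫ s, -lossDiff (τ k) (β k) v s ∂P =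
      -∫ ω', lossDiff (τ k) (β k) v (x i₀ ω', y i₀ ω') ∂μ := by
    intro v
    rw [integral_neg, hP, integral_map (hxy i₀).aemeasurable
      (measurable_lossDiff _ _ _).aestronglyMeasurable]
  have key := measure_pi_exists_lt_le (P := P) (ξ := Prod.fst)
    (φ := fun v s => -lossDiff (τ k) (β k) v s) (C := Cx) (n := n) i₀.pos hr measurable_fst hC.1 hPC
    (fun v => (measurable_lossDiff _ _ v).neg)
    (fun v s => by rw [abs_neg]; exact abs_lossDiff_le (hM.level_mem k) _ _ _)
    (fun v v' s => by
      rw [neg_sub_neg, abs_sub_comm]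
      exact abs_lossDiff_sub_le (hM.level_mem k) _ _ _ _) hu
  rw [← hjoint] at key
  simp only [Fintype.card_fin, Nat.cast_add, Nat.cast_one] at key
  refine le_trans ?_ ((Measure.le_map_apply (measurable_pi_lambda _ hxy).aemeasurable _).trans key)
  refine measure_mono ?_
  rintro ω ⟨v, hv, hlt⟩
  refine ⟨v, hv, ?_⟩
  simp only [hint]
  refine hlt.trans_le (le_of_eq (Finset.sum_congr rfl fun i _ => by ring))

/-- The deterministic argument on the good event. On a sphere of radius `R` around `β` the growth
of the expected loss, of order `R ^ 2`, would exceed the sum of the deviation of the empirical loss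
and the penalty, so no minimizer lies outside the ball. -/
lemma coefNorm_sub_le_of_isEstimate (hM : Model μ x y τ β)
    (hD : DensityCondition μ x y β c₁ c₂) (hC : BoundedCovariates μ x Cx)
    (hE : EigenvalueCondition μ x β b B bt Bt) (hN : NonlinearityCondition μ x β c₁ c₂ B dt)
    (hn : 0 < n) (hK : 0 < K) {lam R u : ℝ} (hlam : 0 < lam) (hR : 0 < R) (hu : 0 ≤ u)
    (hRdt : R ≤ dt) (i₀ : Fin n)
    (hbound : 12 * √K * √((activeSet β).card + 1) * (Cx * u / √n) + lam * √(activeSet β).card <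
      c₁ * bt / 3 * R)
    {ω : Ω}
    (hscore : ∀ j, groupNorm (scoreSum τ β (fun i => x i ω) (fun i => y i ω)) j ≤ n * (lam / 2))
    (hemp : ∀ k, ∀ l < K, ∀ v : Fin (p + 1) → ℝ,
      ∑ j, |v j| ≤ 4 * √K * √((activeSet β).card + 1) * R / 2 ^ l →
        ∑ i, ((∫ ω', lossDiff (τ k) (β k) v (x i₀ ω', y i₀ ω') ∂μ) -
          lossDiff (τ k) (β k) v (x i ω, y i ω)) ≤
        4 * √K * √((activeSet β).card + 1) * R / 2 ^ l * (Cx * u * √n))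
    {βhat : Coef K p} (hest : IsEstimate τ lam (fun i => x i ω) (fun i => y i ω) βhat) :
    coefNorm (βhat - β) ≤ R := by
  by_contra hfar
  obtain ⟨Δ, hΔR, hobj⟩ := exists_coefNorm_eq_of_isEstimate (β := β) hlam.le hR hest
    (not_le.1 hfar)
  have hn' : (0 : ℝ) < n := by exact_mod_cast hn
  have hsn : 0 < √(n : ℝ) := Real.sqrt_pos.2 hn'
  have hcone := mem_cone_of_objective_le hn hlam hobj hscore
  have havg := average_lossDiff_le hlam.le hobj
  have hpeel := sum_le_three_mul_of_dyadic (v := Δ) hK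
    (by positivity : 0 ≤ 4 * √K * √((activeSet β).card + 1) * R)
    (mul_nonneg (mul_nonneg hC.1.le hu) hsn.le)
    (fun v : Fin (p + 1) → ℝ => Finset.sum_nonneg fun j _ => abs_nonneg (v j)) hemp
    (hΔR ▸ sum_abs_le_of_mem_cone hcone)
  have hpop : c₁ * bt / 3 * R ^ 2 ≤
      ∑ k, ∫ ω', lossDiff (τ k) (β k) (Δ k) (x i₀ ω', y i₀ ω') ∂μ := by
    rw [← hΔR, coefNorm_sq_eq_sum_block, Finset.mul_sum]
    refine Finset.sum_le_sum fun k _ => ?_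
    exact integral_lossDiff_ge_of_mem_cone hM hD hC hE hN hcone i₀ k
      (((l2norm_block_le_coefNorm Δ k).trans hΔR.le).trans hRdt)
  simp only [Finset.sum_sub_distrib, Finset.sum_const, Finset.card_univ, Fintype.card_fin,
    nsmul_eq_mul, ← Finset.mul_sum] at hpeel
  rw [hΔR, one_div, inv_mul_eq_div, div_le_iff₀ hn'] at havg
  have h1 := mul_le_mul_of_nonneg_left hpop hn'.le
  have h2 : (n : ℝ) * (Cx * u / √n) = Cx * u * √n := by
    rw [mul_div_left_comm, Real.div_sqrt]
  have h3 := mul_lt_mul_of_pos_left hbound (mul_pos hn' hR)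
  have h4 : n * R * (12 * √K * √((activeSet β).card + 1) * (Cx * u / √n)) =
      3 * (4 * √K * √((activeSet β).card + 1) * R) * (Cx * u * √n) := by
    rw [← h2]; ring
  linarith

lemma deltaStar_eq (n K p s : ℕ) (Cstar D₁ : ℝ) :
    deltaStar n K p s Cstar D₁ = 8 * (Cstar * (√((s : ℝ) + 1) / √n)) *
      (4 * (D₁ * √(Real.log p)) + √2 * √K) := by
  rw [deltaStar, Real.sqrt_div (by positivity), Real.sqrt_mul zero_le_two]
  ring

/-- The deviation of the empirical loss at level `u ^ 2 = 8 (D₁ log p + K)` is less than half of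
`δ*`. -/
lemma empirical_lt_half_deltaStar {s : ℕ} (hn : 0 < n) (hK : 0 < K) (hC : 0 < Cx)
    (hD₁ : 1 ≤ D₁) (hlog : 2 / 3 ≤ Real.log p) (hA : 10 * Cx * √K ≤ Cstar) :
    12 * √K * √((s : ℝ) + 1) * (Cx * √(8 * (D₁ * Real.log p + K)) / √n) <
      deltaStar n K p s Cstar D₁ / 2 := by
  have hn' : (0 : ℝ) < n := by exact_mod_cast hn
  have hK' : (1 : ℝ) ≤ K := by exact_mod_cast hK
  rw [deltaStar_eq]
  set e := √(Real.log p) with he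
  have he2 : e ^ 2 = Real.log p := Real.sq_sqrt (by linarith)
  have he0 : 0 < e := Real.sqrt_pos.2 (by linarith)
  have hk2 : √(K : ℝ) ^ 2 = K := Real.sq_sqrt (by linarith)
  set q : ℝ := √((s : ℝ) + 1) / √n with hq
  have hq0 : 0 < q := by positivity
  have hu : √(8 * (D₁ * Real.log p + K)) ≤ 3 * (D₁ * e + √K) := by
    refine Real.sqrt_le_iff.2 ⟨by positivity, ?_⟩
    have h2 : D₁ * e ^ 2 ≤ D₁ ^ 2 * e ^ 2 :=
      mul_le_mul_of_nonneg_right (by nlinarith) (sq_nonneg _)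
    have h3 : 0 ≤ D₁ * e * √K := by positivity
    have h4 : 0 ≤ D₁ ^ 2 * e ^ 2 := by positivity
    have h5 : (3 * (D₁ * e + √K)) ^ 2 = 9 * (D₁ ^ 2 * e ^ 2) + 18 * (D₁ * e * √K) + 9 * K := by
      linear_combination 9 * hk2
    rw [← he2, h5]
    linarith
  have hW0 : 0 < Cx * √K * q := by positivity
  have h0 : 12 * √K * √((s : ℝ) + 1) * (Cx * √(8 * (D₁ * Real.log p + K)) / √n) =
      12 * (Cx * √K * q) * √(8 * (D₁ * Real.log p + K)) := by rw [hq]; ring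
  have h1 := mul_le_mul_of_nonneg_left hu (by positivity : 0 ≤ 12 * (Cx * √K * q))
  have hs2 : 1 ≤ √(2 : ℝ) := Real.one_le_sqrt.2 (by norm_num)
  have hDe : 0 < D₁ * e := by positivity
  have h2 : 10 * (Cx * √K * q) ≤ Cstar * q := by
    have := mul_le_mul_of_nonneg_right hA hq0.le
    linarith
  have h3 : D₁ * e + √K ≤ 4 * (D₁ * e) + √2 * √K := by
    have := le_mul_of_one_le_left (Real.sqrt_nonneg (K : ℝ)) hs2
    linarith
  have h4 := mul_le_mul h2 h3 (by positivity) (le_trans (by positivity) h2)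
  have h5 : 0 < Cx * √K * q * (D₁ * e + √K) := by positivity
  rw [h0]
  linarith

lemma penalty_le_half_deltaStar {s : ℕ} (hn : 0 < n) (hK : 0 < K) (hC : 0 < Cx)
    (hD₁ : 1 ≤ D₁) (hD₂ : 1 ≤ D₂) (hlog : 2 / 3 ≤ Real.log p)
    (hA : 10 * Cx * √(K * (1 + D₂)) ≤ Cstar) :
    tuning n K p Cx D₂ * √s ≤ deltaStar n K p s Cstar D₁ / 2 := by
  have hn' : (0 : ℝ) < n := by exact_mod_cast hn
  have hK' : (1 : ℝ) ≤ K := by exact_mod_cast hK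
  rw [deltaStar_eq, tuning_eq (by linarith) hn'.le]
  rw [Real.sqrt_mul (by linarith)] at hA
  have h3 : √(D₂ * Real.log p) ≤ √(1 + D₂) * √(Real.log p) := by
    rw [← Real.sqrt_mul (by linarith)]
    exact Real.sqrt_le_sqrt (mul_le_mul_of_nonneg_right (by linarith) (by linarith))
  have he0 : 4 / 5 ≤ √(Real.log p) := Real.le_sqrt_of_sq_le (by norm_num; linarith)
  have hd1 : 1 ≤ √(1 + D₂) := Real.one_le_sqrt.2 (by linarith)
  set e := √(Real.log p) with he
  set d := √(1 + D₂) with hd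
  set q : ℝ := √((s : ℝ) + 1) / √n with hq
  have hq0 : 0 < q := by positivity
  set W : ℝ := Cx * √K * q with hW
  have hW0 : 0 < W := by positivity
  have h1 : 10 * W * d ≤ Cstar * q := by
    have := mul_le_mul_of_nonneg_right hA hq0.le
    rw [hW]; linarith
  have h2 : Cx * √K / √n * (1 + 2 * √(D₂ * Real.log p)) * √s ≤ W * (1 + 2 * (d * e)) := by
    have h4 : √(s : ℝ) ≤ √((s : ℝ) + 1) := Real.sqrt_le_sqrt (by linarith)
    calc Cx * √K / √n * (1 + 2 * √(D₂ * Real.log p)) * √s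
        ≤ Cx * √K / √n * (1 + 2 * (d * e)) * √((s : ℝ) + 1) := by gcongr
      _ = W * (1 + 2 * (d * e)) := by rw [hW, hq]; ring
  have h6 : 4 * e ≤ 4 * (D₁ * e) + √2 * √K := by
    have h7 : 0 ≤ √2 * √(K : ℝ) := by positivity
    have h8 := le_mul_of_one_le_left (by linarith : 0 ≤ e) hD₁
    linarith
  have h7 := mul_le_mul h1 h6 (by linarith) (le_trans (by positivity) h1)
  have h8 : 4 / 5 ≤ d * e := he0.trans (le_mul_of_one_le_left (by linarith) hd1)
  have h9 := mul_le_mul_of_nonneg_left h8 hW0.le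
  linarith

/-- The numerical comparison behind the error bound. If `c₂ < 1` the penalty term of the bound is
too small to pay for the penalty, which is then charged to the other half of `δ*`. -/
lemma empirical_add_penalty_lt {s : ℕ} (hn : 0 < n) (hK : 0 < K) (hC : 0 < Cx)
    (hD₁ : 1 ≤ D₁) (hD₂ : 1 ≤ D₂) (hlog : 2 / 3 ≤ Real.log p) (hc₂ : 0 < c₂) (hc₁bt : 0 < c₁ * bt)
    (hA : 10 * Cx * √K ≤ Cstar) (hA' : c₂ < 1 → 10 * Cx * √(K * (1 + D₂)) ≤ Cstar) :
    12 * √K * √((s : ℝ) + 1) * (Cx * √(8 * (D₁ * Real.log p + K)) / √n) +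
        tuning n K p Cx D₂ * √s <
      c₁ * bt / 3 * errorBound n K p s Cstar D₁ c₁ c₂ bt Bt (tuning n K p Cx D₂) := by
  have hlam0 : 0 ≤ tuning n K p Cx D₂ := by unfold tuning; positivity
  have hemp := empirical_lt_half_deltaStar (s := s) hn hK hC hD₁ hlog hA
  have hδ0 : 0 < deltaStar n K p s Cstar D₁ := by
    have : 0 ≤ 12 * √K * √((s : ℝ) + 1) * (Cx * √(8 * (D₁ * Real.log p + K)) / √n) := by positivity
    linarith
  have hpen := fun h => penalty_le_half_deltaStar (s := s) hn hK hC hD₁ hD₂ hlog (hA' h)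
  set lam := tuning n K p Cx D₂
  have hbound : deltaStar n K p s Cstar D₁ + c₂ * lam * √s ≤
      c₁ * bt / 3 * errorBound n K p s Cstar D₁ c₁ c₂ bt Bt lam := by
    rw [errorBound, ← mul_assoc, div_mul_div_cancel₀ (by norm_num), div_self hc₁bt.ne', one_mul]
    have := le_max_left (deltaStar n K p s Cstar D₁) (K * √(8 * Bt / n))
    linarith
  have hls : 0 ≤ lam * √s := by positivity
  rcases lt_or_ge c₂ 1 with h | h
  · have h1 := hpen h
    have h2 : 0 ≤ c₂ * lam * √s := by positivity
    linarith
  · have := mul_le_mul_of_nonneg_right h hls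
    linarith

/-- The two families of bad events have total probability at most `2 p^(1-D₂) + 16 p^(1-D₁)`;
the factor `K ^ 2` from the union over blocks and peeling levels is absorbed by `exp (-K)`. -/
lemma bad_event_sum_le (hp : 1 ≤ p) (D₁ D₂ : ℝ) (K : ℕ) (h0 : 0 ≤ D₁ * Real.log p) :
    (p + 1) * (p : ℝ) ^ (-D₂) + K * (K * (2 * (p + 1) *
      Real.exp (-(√(8 * (D₁ * Real.log p + K)) ^ 2 / 8)))) ≤
      16 * (p : ℝ) ^ (1 - D₁) + 2 * (p : ℝ) ^ (1 - D₂) := by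
  have hp0 : (0 : ℝ) < p := by exact_mod_cast hp
  have hp1 : (1 : ℝ) ≤ p := by exact_mod_cast hp
  have hK : (0 : ℝ) ≤ K := Nat.cast_nonneg K
  rw [Real.sq_sqrt (by positivity), mul_div_cancel_left₀ _ (by norm_num), neg_add, Real.exp_add,
    show -(D₁ * Real.log p) = Real.log p * -D₁ by ring, ← Real.rpow_def_of_pos hp0,
    sub_eq_add_neg, sub_eq_add_neg, Real.rpow_add hp0, Real.rpow_add hp0, Real.rpow_one]
  have h1 : (0 : ℝ) < (p : ℝ) ^ (-D₁) := Real.rpow_pos_of_pos hp0 _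
  have h2 : (0 : ℝ) < (p : ℝ) ^ (-D₂) := Real.rpow_pos_of_pos hp0 _
  have h3 : (K : ℝ) ^ 2 * Real.exp (-K) ≤ 2 := by
    rw [Real.exp_neg, mul_inv_le_iff₀ (Real.exp_pos _)]
    linarith [Real.quadratic_le_exp_of_nonneg hK]
  have h4 : (p + 1) * (p : ℝ) ^ (-D₂) ≤ 2 * (p * (p : ℝ) ^ (-D₂)) := by nlinarith
  have h5 : 2 * ((p : ℝ) + 1) * (p : ℝ) ^ (-D₁) * (K ^ 2 * Real.exp (-K)) ≤
      4 * (p * (p : ℝ) ^ (-D₁)) * 2 := by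
    refine mul_le_mul ?_ h3 (by positivity) (by positivity)
    nlinarith
  have h6 : 0 < (p : ℝ) * (p : ℝ) ^ (-D₁) := by positivity
  linarith

/-- The good event is the complement of a measurable hull of the bad events, since a supremum over
uncountably many `v` is not obviously measurable. When the claimed probability is not positive the
empty event is used. -/
lemma exists_event_coefNorm_sub_le (hn : 1 ≤ n) (hK : 1 ≤ K) (hp : 1 ≤ p) (hM : Model μ x y τ β)
    (hD : DensityCondition μ x y β c₁ c₂) (hC : BoundedCovariates μ x Cx)
    (hE : EigenvalueCondition μ x β b B bt Bt) (hN : NonlinearityCondition μ x β c₁ c₂ B dt)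
    (hA : 10 * Cx * √K ≤ Cstar) (hA' : c₂ < 1 → 10 * Cx * √(K * (1 + D₂)) ≤ Cstar)
    (hR : errorBound n K p (activeSet β).card Cstar D₁ c₁ c₂ bt Bt (tuning n K p Cx D₂) < dt) :
    ∃ E : Set Ω, MeasurableSet E ∧
      1 - 16 * (p : ℝ) ^ (1 - D₁) - 2 * (p : ℝ) ^ (1 - D₂) ≤ μ.real E ∧
      ∀ ω ∈ E, ∀ βhat : Coef K p,
        IsEstimate τ (tuning n K p Cx D₂) (fun i => x i ω) (fun i => y i ω) βhat →
        coefNorm (βhat - β) ≤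
          errorBound n K p (activeSet β).card Cstar D₁ c₁ c₂ bt Bt (tuning n K p Cx D₂) := by
  rcases le_or_gt (1 - 16 * (p : ℝ) ^ (1 - D₁) - 2 * (p : ℝ) ^ (1 - D₂)) 0 with htriv | hprob
  · exact ⟨∅, MeasurableSet.empty, by simpa using htriv, by simp⟩
  -- a positive probability bound forces `p ≥ 2` and `D₁, D₂ > 1`
  have hp1 : (1 : ℝ) ≤ p := by exact_mod_cast hp
  have hpow₁ : (0 : ℝ) ≤ (p : ℝ) ^ (1 - D₁) := by positivity
  have hpow₂ : (0 : ℝ) ≤ (p : ℝ) ^ (1 - D₂) := by positivity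
  have hD₁ : 1 ≤ D₁ := by
    by_contra h
    have := Real.one_le_rpow hp1 (by linarith : 0 ≤ 1 - D₁)
    linarith
  have hD₂ : 1 ≤ D₂ := by
    by_contra h
    have := Real.one_le_rpow hp1 (by linarith : 0 ≤ 1 - D₂)
    linarith
  have hp2 : (2 : ℝ) ≤ p := by
    have : p ≠ 1 := by
      rintro rfl
      norm_num at hprob
    exact_mod_cast (by omega : 2 ≤ p)
  have hlog : 2 / 3 ≤ Real.log p := by
    have := Real.log_le_log zero_lt_two hp2
    linarith [Real.log_two_gt_d9]
  set s := (activeSet β).card with hs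
  set lam := tuning n K p Cx D₂ with hlam
  set R := errorBound n K p s Cstar D₁ c₁ c₂ bt Bt lam with hRdef
  set u := √(8 * (D₁ * Real.log p + K)) with hu
  have hn0 : 0 < n := hn
  have hK0 : 0 < K := hK
  have hC0 := hC.1
  have hc₁bt : 0 < c₁ * bt := mul_pos hD.1 hE.1
  have hlam0 : 0 < lam := by rw [hlam]; unfold tuning; positivity
  have hu0 : 0 ≤ u := Real.sqrt_nonneg _
  have hbound := empirical_add_penalty_lt (s := s) (Bt := Bt) hn hK hC0 hD₁ hD₂ hlog hD.2.1 hc₁bt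
    hA hA'
  have hR0 : 0 < R := by
    have h1 : 0 < c₁ * bt / 3 * R := lt_of_le_of_lt (by positivity) hbound
    exact pos_of_mul_pos_right h1 (by positivity)
  let i₀ : Fin n := ⟨0, hn0⟩
  set M : ℝ := 4 * √K * √((s : ℝ) + 1) * R with hMdef
  have hM0 : 0 < M := by positivity
  set U : Fin (p + 1) → Set Ω := fun j => {ω | n * (lam / 2) <
    groupNorm (scoreSum τ β (fun i => x i ω) (fun i => y i ω)) j} with hU
  set V : Fin K → Fin K → Set Ω := fun k l => {ω | ∃ v : Fin (p + 1) → ℝ,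
    ∑ j, |v j| ≤ M / 2 ^ (l : ℕ) ∧ M / 2 ^ (l : ℕ) * (Cx * u * √n) <
        ∑ i, ((∫ ω', lossDiff (τ k) (β k) v (x i₀ ω', y i₀ ω') ∂μ) -
          lossDiff (τ k) (β k) v (x i ω, y i ω))} with hV
  set bad : Set Ω := (⋃ j, U j) ∪ ⋃ k, ⋃ l, V k l with hbad
  have hD₂log : 1 / 16 ≤ D₂ * Real.log p := by nlinarith
  have hμU : μ (⋃ j, U j) ≤ ENNReal.ofReal ((p + 1) * (p : ℝ) ^ (-D₂)) := by
    refine (measure_iUnion_fintype_le μ U).trans ((Finset.sum_le_sum fun j _ =>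
      measure_groupNorm_scoreSum_gt_le hn0 hK0 hp hM hC hD₂log j).trans (le_of_eq ?_))
    rw [Finset.sum_const, Finset.card_univ, Fintype.card_fin, nsmul_eq_mul,
      ← ENNReal.ofReal_natCast, ← ENNReal.ofReal_mul (by positivity)]
    push_cast
    rfl
  have hμV : μ (⋃ k, ⋃ l, V k l) ≤
      ENNReal.ofReal (K * (K * (2 * (p + 1) * Real.exp (-(u ^ 2 / 8))))) := by
    refine (measure_iUnion_fintype_le μ _).trans ((Finset.sum_le_sum fun k _ =>
      (measure_iUnion_fintype_le μ _).trans (Finset.sum_le_sum fun l _ =>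
        measure_empirical_lossDiff_gt_le hM hC i₀ k (by positivity) hu0)).trans (le_of_eq ?_))
    simp only [Finset.sum_const, Finset.card_univ, Fintype.card_fin, nsmul_eq_mul]
    rw [← ENNReal.ofReal_natCast, ← ENNReal.ofReal_mul (by positivity),
      ← ENNReal.ofReal_mul (by positivity)]
  have hμbad : μ bad ≤ ENNReal.ofReal (16 * (p : ℝ) ^ (1 - D₁) + 2 * (p : ℝ) ^ (1 - D₂)) := by
    refine (measure_union_le _ _).trans ((add_le_add hμU hμV).trans ?_)
    rw [← ENNReal.ofReal_add (by positivity) (by positivity)]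
    exact ENNReal.ofReal_le_ofReal (bad_event_sum_le hp D₁ D₂ K (by positivity))
  refine ⟨(toMeasurable μ bad)ᶜ, (measurableSet_toMeasurable μ bad).compl, ?_, ?_⟩
  · rw [probReal_compl_eq_one_sub (measurableSet_toMeasurable μ bad)]
    have : μ.real (toMeasurable μ bad) ≤
        16 * (p : ℝ) ^ (1 - D₁) + 2 * (p : ℝ) ^ (1 - D₂) := by
      rw [measureReal_def, measure_toMeasurable]
      exact ENNReal.toReal_le_of_le_ofReal (by positivity) hμbad
    linarith
  · intro ω hω βhat hest
    have hω' : ω ∉ bad := fun h => hω (subset_toMeasurable μ bad h)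
    simp only [hbad, hU, hV, Set.mem_union, Set.mem_iUnion, Set.mem_ofPred_eq, not_or, not_exists,
      not_and, not_lt] at hω'
    exact coefNorm_sub_le_of_isEstimate hM hD hC hE hN hn0 hK0 hlam0 hR0 hu0 hR.le i₀ hbound
      hω'.1 (fun k l hl v hv => hω'.2 k ⟨l, hl⟩ v hv) hest

end Assembly

end GQLasso

end

theorem theorem1 :
    ∃ A : ℝ, 0 < A ∧
      ∀ (n K p : ℕ), 1 ≤ n → 1 ≤ K → 1 ≤ p →
      ∀ (Ω : Type*) [MeasurableSpace Ω] (μ : MeasureTheory.Measure Ω)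
        [MeasureTheory.IsProbabilityMeasure μ]
        (x : Fin n → Ω → Fin (p + 1) → ℝ) (y : Fin n → Ω → ℝ) (τ : Fin K → ℝ)
        (β : GQLasso.Coef K p) (c₁ c₂ Cx : ℝ) (b B : Fin K → ℝ) (bt Bt dt D₁ D₂ Cstar : ℝ),
        GQLasso.Model μ x y τ β →
        GQLasso.DensityCondition μ x y β c₁ c₂ →
        GQLasso.BoundedCovariates μ x Cx →
        GQLasso.EigenvalueCondition μ x β b B bt Bt →
        GQLasso.NonlinearityCondition μ x β c₁ c₂ B dt →
        0 < D₁ → 0 < D₂ →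
        A * Cx * √K ≤ Cstar →
        (c₂ < 1 → A * Cx * √(K * (1 + D₂)) ≤ Cstar) →
        GQLasso.errorBound n K p (GQLasso.activeSet β).card Cstar D₁ c₁ c₂ bt Bt
          (GQLasso.tuning n K p Cx D₂) < dt →
        ∃ E : Set Ω, MeasurableSet E ∧
          1 - 16 * (p : ℝ) ^ (1 - D₁) - 2 * (p : ℝ) ^ (1 - D₂) ≤ μ.real E ∧
          ∀ ω ∈ E, ∀ βhat : GQLasso.Coef K p,
            GQLasso.IsEstimate τ (GQLasso.tuning n K p Cx D₂)
              (fun i => x i ω) (fun i => y i ω) βhat →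
            GQLasso.coefNorm (βhat - β) ≤
              GQLasso.errorBound n K p (GQLasso.activeSet β).card Cstar D₁ c₁ c₂ bt Bt
                (GQLasso.tuning n K p Cx D₂) := by
  refine ⟨10, by norm_num, ?_⟩
  intro n K p hn hK hp Ω _ μ _ x y τ β c₁ c₂ Cx b B bt Bt dt D₁ D₂ Cstar hM hD hC hE hN _ _ hA hA'
    hR
  exact GQLasso.exists_event_coefNorm_sub_le hn hK hp hM hD hC hE hN hA hA' hR
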